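/- Let $M$ be a smooth manifold (finite-dimensional, Hausdorff, second countable), $\mathfrak g$ a finite-dimensional real Lie algebra and $p\colon L\to M$ a smooth Lie algebra bundle with fibre $\mathfrak g$. Let $\mathrm{Aut}\,\mathfrak g$ be the group of Lie algebra automorphisms of $\mathfrak g$ and $\mathrm{Inn}\,\mathfrak g$ its subgroup generated by the automorphisms $\exp(\mathrm{ad}\,u)$, $u\in\mathfrak g$. Let $\mathrm{Aut}^\delta\mathfrak g$ be $\mathrm{Aut}\,\mathfrak g$ with the coarsest topology that is finer than the usual one and makes the quotient $\mathrm{Aut}\,\mathfrak g/\mathrm{Inn}\,\mathfrak g$ discrete. A locally trivial $\mathrm{Aut}^\delta\mathfrak g$-structure on $L$ is a family $\Phi=\{\varphi_\alpha\}$ of smooth trivializations $\varphi_\alpha\colon U_\alpha\times\mathfrak g\to p^{-1}(U_\alpha)$, Lie algebra isomorphisms on the fibres, over an open covering $\{U_\alpha\}$ of $M$, such that all maps $x\mapsto\varphi_\beta(x)^{-1}\varphi_\alpha(x)$, $U_\alpha\cap U_\beta\to\mathrm{Aut}^\delta\mathfrak g$, are continuous. Two such structures $\Phi$ and $\Phi'=\{\varphi'_\beta\}$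 (over coverings $\{U_\alpha\}$ and $\{U'_\beta\}$) are equivalent if all maps $x\mapsto\varphi'_\beta(x)^{-1}\varphi_\alpha(x)$, $U_\alpha\cap U'_\beta\to\mathrm{Aut}^\delta\mathfrak g$, are continuous. $LAB^\delta(L)$ is the set of equivalence classes. Consider smooth linear connections $\nabla$ on $L$ with $\nabla_X[u,v]=[\nabla_Xu,v]+[u,\nabla_Xv]$ whose curvature is inner, that is $R^\nabla(X,Y)u=[\Omega(X,Y),u]$ for some smooth $L$-valued 2-form $\Omega$ on $M$. Two such connections belong to the same class if $\nabla'_Xu=\nabla_Xu+[l(X),u]$ for some smooth bundle map $l\colon TM\to L$. $Coup(L)$ is the set of classes (the couplings of $L$ with $TM$). For a locally trivial $\mathrm{Aut}^\delta\mathfrak g$-structure $\Phi$ and a smooth partition of unity $H=\{h_\alpha\}$ subordinate to $\{U_\alpha\}$ put $$\nabla^{\Phi,H}_X(u)=\sum_\alpha\nabla^{\Phi,\alpha}_X(h_\alpha u),\qquad (\nabla^{\Phi,\alpha}_Xv)(x)=\varphi_\alpha(x)\,\frac{\partial}{\partial X}\bigl(\varphi_\alpha^{-1}v\bigr)(x)\quad(x\in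 U_\alpha).$$ Theorem. $\nabla^{\Phi,H}$ is a smooth linear connection on $L$, a derivation of the fibrewise bracket, with inner curvature. Its class in $Coup(L)$ does not depend on the choice of $\Phi$ within its equivalence class or on the choice of $H$. Hence there is exactly one map $g\colon LAB^\delta(L)\to Coup(L)$ with $g([\Phi])=[\nabla^{\Phi,H}]$ for all $\Phi$ and all $H$ subordinate to the covering of $\Phi$. -/

import Mathlib

open Set Bundle
open scoped Manifold ContDiff Topology

universe w u₁ u₂ u₃ u₄ u₅

noncomputable section

/-! ### Finite-dimensional Lie algebras -/

/-- A Lie ring whose underlying additive group carries a norm. The class only makes sure that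
`NormedAddCommGroup` and `LieRing` use the same addition; no compatibility between norm and
bracket is required. -/
class LieNormedGroup (𝔤 : Type*) extends NormedAddCommGroup 𝔤, LieRing 𝔤

/-- A real Lie algebra whose underlying vector space is normed (again only sharing the linear
structure). Every finite-dimensional real Lie algebra can be given such a norm, and all norms on it
define the same topology. -/
class LieNormedSpace (𝔤 : Type*) [LieNormedGroup 𝔤] extends NormedSpace ℝ 𝔤, LieAlgebra ℝ 𝔤

section AutDelta

variable (𝔤 : Type*) [LieNormedGroup 𝔤] [LieNormedSpace 𝔤]

/-- The group `Aut 𝔤` of Lie algebra automorphisms of `𝔤`; as a topological space it will carry the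
topology of `Aut^δ 𝔤`. -/
def AutDelta : Type _ := 𝔤 ≃ₗ⁅ℝ⁆ 𝔤

namespace AutDelta

variable {𝔤}

/-- The underlying Lie algebra automorphism. -/
def toLieEquiv (φ : AutDelta 𝔤) : 𝔤 ≃ₗ⁅ℝ⁆ 𝔤 := φ

/-- Composition of automorphisms: `(φ * ψ) v = φ (ψ v)`. -/
instance : Group (AutDelta 𝔤) where
  mul φ ψ := LieEquiv.trans ψ.toLieEquiv φ.toLieEquiv
  one := LieEquiv.refl
  inv φ := LieEquiv.symm φ.toLieEquiv
  mul_assoc _ _ _ := rfl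
  one_mul _ := rfl
  mul_one _ := rfl
  inv_mul_cancel φ := LieEquiv.ext (fun v => φ.toLieEquiv.symm_apply_apply v)

variable [FiniteDimensional ℝ 𝔤]

/-- An automorphism as a continuous linear map. -/
def toCLM (φ : AutDelta 𝔤) : 𝔤 →L[ℝ] 𝔤 :=
  LinearMap.toContinuousLinearMap (φ.toLieEquiv.toLinearEquiv : 𝔤 →ₗ[ℝ] 𝔤)

variable (𝔤) in
/-- The usual topology of `Aut 𝔤`, as a subspace of the linear endomorphisms of `𝔤`. -/
abbrev usualTopology : TopologicalSpace (AutDelta 𝔤) :=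
  TopologicalSpace.induced toCLM inferInstance

variable (𝔤) in
/-- The group `Inn 𝔤` of inner automorphisms: the subgroup of `Aut 𝔤` generated by the
automorphisms `exp (ad u)`, `u ∈ 𝔤`. -/
def inn : Subgroup (AutDelta 𝔤) :=
  Subgroup.closure {φ | ∃ u : 𝔤,
    φ.toCLM = NormedSpace.exp (LinearMap.toContinuousLinearMap (LieAlgebra.ad ℝ 𝔤 u))}

/-- The topology of `Aut^δ 𝔤`: the coarsest topology which is finer than the usual topology of
`Aut 𝔤` and for which `Aut 𝔤 → Aut 𝔤 / Inn 𝔤` is continuous for the discrete topology on the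
quotient. -/
instance : TopologicalSpace (AutDelta 𝔤) :=
  usualTopology 𝔤 ⊓
    TopologicalSpace.induced (QuotientGroup.mk : AutDelta 𝔤 → AutDelta 𝔤 ⧸ inn 𝔤) ⊥

lemma toCLM_apply (φ : AutDelta 𝔤) (v : 𝔤) : φ.toCLM v = φ.toLieEquiv v := rfl

lemma toCLM_mul (φ ψ : AutDelta 𝔤) : (φ * ψ).toCLM = φ.toCLM * ψ.toCLM := rfl

lemma toCLM_one : (1 : AutDelta 𝔤).toCLM = 1 := rfl

/-- An automorphism as a unit of the algebra of continuous linear endomorphisms. -/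
def toUnit (φ : AutDelta 𝔤) : (𝔤 →L[ℝ] 𝔤)ˣ where
  val := φ.toCLM
  inv := φ⁻¹.toCLM
  val_inv := by rw [← toCLM_mul, mul_inv_cancel, toCLM_one]
  inv_val := by rw [← toCLM_mul, inv_mul_cancel, toCLM_one]

instance : (inn 𝔤).Normal := by
  constructor
  intro n hn g
  induction hn using Subgroup.closure_induction with
  | mem φ hφ =>
    obtain ⟨u, hu⟩ := hφ
    refine Subgroup.subset_closure ⟨g.toLieEquiv u, ?_⟩
    have h : LinearMap.toContinuousLinearMap (LieAlgebra.ad ℝ 𝔤 (g.toLieEquiv u)) =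
        (g.toUnit : 𝔤 →L[ℝ] 𝔤) * LinearMap.toContinuousLinearMap (LieAlgebra.ad ℝ 𝔤 u) *
          ((g.toUnit⁻¹ : (𝔤 →L[ℝ] 𝔤)ˣ) : 𝔤 →L[ℝ] 𝔤) := by
      ext v
      change ⁅g.toLieEquiv u, v⁆ = g.toLieEquiv ⁅u, g.toLieEquiv.symm v⁆
      rw [LieEquiv.map_lie, LieEquiv.apply_symm_apply]
    let _ : NormedAlgebra ℚ (𝔤 →L[ℝ] 𝔤) := NormedAlgebra.restrictScalars ℚ ℝ (𝔤 →L[ℝ] 𝔤)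
    have : CompleteSpace 𝔤 := FiniteDimensional.complete ℝ 𝔤
    rw [h, NormedSpace.exp_units_conj, ← hu]
    rfl
  | one => simp
  | mul a b _ _ ha hb =>
    have : g * (a * b) * g⁻¹ = (g * a * g⁻¹) * (g * b * g⁻¹) := by group
    rw [this]
    exact mul_mem ha hb
  | inv a _ ha =>
    have : g * a⁻¹ * g⁻¹ = (g * a * g⁻¹)⁻¹ := by group
    rw [this]
    exact inv_mem ha

lemma continuousAt_iff {X : Type*} [TopologicalSpace X] {f : X → AutDelta 𝔤} {x : X} :
    ContinuousAt f x ↔ ContinuousAt (fun y => (f y).toCLM) x ∧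
      ∀ᶠ y in 𝓝 x, (f y : AutDelta 𝔤 ⧸ inn 𝔤) = (f x : AutDelta 𝔤 ⧸ inn 𝔤) := by
  let _ : TopologicalSpace (AutDelta 𝔤 ⧸ inn 𝔤) := ⊥
  have : DiscreteTopology (AutDelta 𝔤 ⧸ inn 𝔤) := ⟨rfl⟩
  have hn : 𝓝 (f x) = @nhds _ (usualTopology 𝔤) (f x) ⊓
      @nhds _ (TopologicalSpace.induced
        (QuotientGroup.mk : AutDelta 𝔤 → AutDelta 𝔤 ⧸ inn 𝔤) ⊥) (f x) :=
    nhds_inf (t₁ := usualTopology 𝔤) (t₂ := TopologicalSpace.induced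
      (QuotientGroup.mk : AutDelta 𝔤 → AutDelta 𝔤 ⧸ inn 𝔤) ⊥)
  unfold ContinuousAt
  rw [hn, Filter.tendsto_inf]
  refine and_congr ?_ ?_
  · unfold usualTopology
    rw [nhds_induced, Filter.tendsto_comap_iff]
    rfl
  · rw [nhds_induced, Filter.tendsto_comap_iff, nhds_discrete (AutDelta 𝔤 ⧸ inn 𝔤), Filter.tendsto_pure]
    rfl

lemma continuousAt_mul {X : Type*} [TopologicalSpace X] {f g : X → AutDelta 𝔤} {x : X}
    (hf : ContinuousAt f x) (hg : ContinuousAt g x) : ContinuousAt (fun y => f y * g y) x := by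
  rw [continuousAt_iff] at *
  refine ⟨hf.1.mul hg.1, ?_⟩
  filter_upwards [hf.2, hg.2] with y h₁ h₂
  rw [QuotientGroup.mk_mul, QuotientGroup.mk_mul, h₁, h₂]

lemma continuousAt_inv {X : Type*} [TopologicalSpace X] {f : X → AutDelta 𝔤} {x : X}
    (hf : ContinuousAt f x) : ContinuousAt (fun y => (f y)⁻¹) x := by
  rw [continuousAt_iff] at *
  have : CompleteSpace 𝔤 := FiniteDimensional.complete ℝ 𝔤
  refine ⟨?_, ?_⟩
  · have h : (fun y => ((f y)⁻¹).toCLM) = fun y => Ring.inverse (f y).toCLM := by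
      funext y
      exact (Ring.inverse_unit (f y).toUnit).symm
    rw [h]
    exact (NormedRing.inverse_continuousAt (f x).toUnit).comp (f := fun y => (f y).toCLM) hf.1
  · filter_upwards [hf.2] with y h
    rw [QuotientGroup.mk_inv, QuotientGroup.mk_inv, h]

end AutDelta

end AutDelta

/-! ### Lie algebra bundles

`V : M → Type*` is a smooth vector bundle over `M` with model fibre `𝔤`, every fibre `V x` of which
is a Lie algebra. -/

section Bundle

variable {E : Type u₁} [NormedAddCommGroup E] [NormedSpace ℝ E]
  {H : Type u₂} [TopologicalSpace H] (I : ModelWithCorners ℝ E H)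
  {M : Type u₃} [TopologicalSpace M] [ChartedSpace H M]
  (𝔤 : Type u₄) [LieNormedGroup 𝔤] [LieNormedSpace 𝔤]
  (V : M → Type u₅) [TopologicalSpace (TotalSpace 𝔤 V)]
  [∀ x, LieRing (V x)] [∀ x, LieAlgebra ℝ (V x)] [∀ x, TopologicalSpace (V x)]
  [FiberBundle 𝔤 V]

/-- A smooth local trivialization `p⁻¹(U) ≅ U × 𝔤` which on every fibre is an isomorphism of Lie
algebras. In the usual notation `φ_α : U_α × 𝔤 → p⁻¹(U_α)` is the inverse of `triv`. -/
structure LieTrivialization where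
  /-- the trivialization -/
  triv : Trivialization 𝔤 (π 𝔤 V)
  isLinear : triv.IsLinear ℝ
  contMDiffOn : ContMDiffOn (I.prod 𝓘(ℝ, 𝔤)) (I.prod 𝓘(ℝ, 𝔤)) ∞ triv triv.source
  contMDiffOn_symm : ContMDiffOn (I.prod 𝓘(ℝ, 𝔤)) (I.prod 𝓘(ℝ, 𝔤)) ∞
    triv.toOpenPartialHomeomorph.symm triv.target
  map_lie : ∀ x ∈ triv.baseSet, ∀ v v' : V x,
    (triv ⟨x, ⁅v, v'⁆⟩).2 = ⁅(triv ⟨x, v⟩).2, (triv ⟨x, v'⟩).2⁆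

attribute [instance] LieTrivialization.isLinear

/-- `V` is a Lie algebra bundle (LAB) with fibre `𝔤`: it is locally trivial as a smooth bundle of
Lie algebras. -/
def IsLieAlgebraBundle : Prop :=
  ∀ x : M, ∃ e : LieTrivialization I 𝔤 V, x ∈ e.triv.baseSet

variable {I 𝔤 V}

/-- The isomorphism `φ(x)⁻¹ : V x ≅ 𝔤` given by a local trivialization. -/
def LieTrivialization.equivAt (e : LieTrivialization I 𝔤 V) (x : M) (hx : x ∈ e.triv.baseSet) :
    V x ≃ₗ⁅ℝ⁆ 𝔤 :=
  { e.triv.linearEquivAt ℝ x hx with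
    map_lie' := fun {v v'} => e.map_lie x hx v v' }

/-- The transition function `x ↦ φ'(x)⁻¹ ∘ φ(x) ∈ Aut 𝔤` between two local trivializations. -/
def LieTrivialization.transition (e e' : LieTrivialization I 𝔤 V)
    (x : ↥(e.triv.baseSet ∩ e'.triv.baseSet)) : AutDelta 𝔤 :=
  ((e.equivAt x x.2.1).symm.trans (e'.equivAt x x.2.2) : 𝔤 ≃ₗ⁅ℝ⁆ 𝔤)

lemma LieTrivialization.transition_inv (e e' : LieTrivialization I 𝔤 V) (x : M)
    (h : x ∈ e.triv.baseSet) (h' : x ∈ e'.triv.baseSet) :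
    e'.transition e ⟨x, h', h⟩ = (e.transition e' ⟨x, h, h'⟩)⁻¹ := rfl

lemma LieTrivialization.transition_mul (e e' e'' : LieTrivialization I 𝔤 V) (x : M)
    (h : x ∈ e.triv.baseSet) (h' : x ∈ e'.triv.baseSet) (h'' : x ∈ e''.triv.baseSet) :
    e.transition e'' ⟨x, h, h''⟩ = e'.transition e'' ⟨x, h', h''⟩ * e.transition e' ⟨x, h, h'⟩ := by
  refine LieEquiv.ext (fun v => ?_)
  change (e''.equivAt x h'') ((e.equivAt x h).symm v) =
    (e''.equivAt x h'') ((e'.equivAt x h').symm ((e'.equivAt x h') ((e.equivAt x h).symm v)))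
  rw [LieEquiv.symm_apply_apply]

variable [FiniteDimensional ℝ 𝔤]

variable (I 𝔤 V) in
/-- A locally trivial structure with structural group `Aut^δ 𝔤` on the bundle `V`: an open covering
`U i` with trivializations over the `U i` whose transition functions
`U i ∩ U j → Aut^δ 𝔤` are continuous. -/
structure DeltaStructure where
  /-- the index set of the covering -/
  ι : Type w
  /-- the trivializations -/
  e : ι → LieTrivialization I 𝔤 V
  cover : ∀ x : M, ∃ i, x ∈ (e i).triv.baseSet
  continuous_transition : ∀ i j, Continuous ((e i).transition (e j))

namespace DeltaStructure

/-- The open sets of the covering. -/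
def U (Φ : DeltaStructure.{w} I 𝔤 V) (i : Φ.ι) : Set M := (Φ.e i).triv.baseSet

/-- Two structures are equivalent if all mixed transition functions
`φ'_j(x)⁻¹ ∘ φ_i(x)` are continuous maps `U_i ∩ U'_j → Aut^δ 𝔤`. -/
def Equivalent (Φ Φ' : DeltaStructure.{w} I 𝔤 V) : Prop :=
  ∀ i j, Continuous ((Φ.e i).transition (Φ'.e j))

end DeltaStructure

lemma LieTrivialization.continuous_transition_symm {e e' : LieTrivialization I 𝔤 V}
    (h : Continuous (e.transition e')) : Continuous (e'.transition e) := by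
  rw [continuous_iff_continuousAt]
  intro x
  have hs : Continuous (fun y : ↥(e'.triv.baseSet ∩ e.triv.baseSet) =>
      (⟨y.1, y.2.2, y.2.1⟩ : ↥(e.triv.baseSet ∩ e'.triv.baseSet))) := by fun_prop
  exact AutDelta.continuousAt_inv (h.comp hs).continuousAt

namespace DeltaStructure

lemma Equivalent.trans {Φ Φ' Φ'' : DeltaStructure.{w} I 𝔤 V} (h : Φ.Equivalent Φ')
    (h' : Φ'.Equivalent Φ'') : Φ.Equivalent Φ'' := by
  intro i k
  obtain ⟨e, he⟩ : ∃ e, e = Φ.e i := ⟨_, rfl⟩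
  obtain ⟨e'', he''⟩ : ∃ e'', e'' = Φ''.e k := ⟨_, rfl⟩
  rw [← he, ← he'', continuous_iff_continuousAt]
  rintro ⟨x, hx, hx''⟩
  obtain ⟨j, hx'⟩ := Φ'.cover x
  obtain ⟨e', he'⟩ : ∃ e', e' = Φ'.e j := ⟨_, rfl⟩
  have h₁ : Continuous (e.transition e') := by rw [he, he']; exact h i j
  have h₂ : Continuous (e'.transition e'') := by rw [he', he'']; exact h' j k
  rw [← he'] at hx'
  have ho : IsOpen {y : ↥(e.triv.baseSet ∩ e''.triv.baseSet) | y.1 ∈ e'.triv.baseSet} :=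
    e'.triv.open_baseSet.preimage continuous_subtype_val
  refine (ho.isOpenEmbedding_subtypeVal.continuousAt_iff (x := ⟨⟨x, hx, hx''⟩, hx'⟩)).1 ?_
  have c₁ : Continuous (fun y : {y : ↥(e.triv.baseSet ∩ e''.triv.baseSet) |
      y.1 ∈ e'.triv.baseSet} =>
        e.transition e' ⟨y.1.1, y.1.2.1, y.2⟩) := h₁.comp (by fun_prop)
  have c₂ : Continuous (fun y : {y : ↥(e.triv.baseSet ∩ e''.triv.baseSet) |
      y.1 ∈ e'.triv.baseSet} =>
        e'.transition e'' ⟨y.1.1, y.2, y.1.2.2⟩) := h₂.comp (by fun_prop)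
  refine (AutDelta.continuousAt_mul c₂.continuousAt c₁.continuousAt).congr
    (Filter.Eventually.of_forall fun y => ?_)
  exact (e.transition_mul e' e'' y.1.1 y.1.2.1 y.2 y.1.2.2).symm

variable (I 𝔤 V) in
/-- Equivalence of locally trivial structures. -/
instance setoid : Setoid (DeltaStructure.{w} I 𝔤 V) where
  r := Equivalent
  iseqv :=
    { refl := fun Φ => Φ.continuous_transition
      symm := fun h i j => LieTrivialization.continuous_transition_symm (h j i)
      trans := Equivalent.trans }

end DeltaStructure

variable (I 𝔤 V) in
/-- The set `LAB^δ(L)` of equivalence classes of locally trivial structures with structural group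
`Aut^δ 𝔤` on the bundle `V`. -/
def LABDelta := Quotient (DeltaStructure.setoid.{w} I 𝔤 V)

/-! ### Couplings -/

variable [∀ x, IsTopologicalAddGroup (V x)] [∀ x, ContinuousSMul ℝ (V x)]
  [IsManifold I ∞ M] [VectorBundle ℝ 𝔤 V]

variable (I 𝔤 V) in
/-- A smooth bundle map `l : TM → L`, i.e. a smooth 1-form with values in `V`. -/
structure OneForm where
  /-- the values of the form -/
  toFun : ∀ x : M, TangentSpace I x →L[ℝ] V x
  contMDiff : ∀ X : Cₛ^∞⟮I; E, (TangentSpace I : M → Type _)⟯,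
    ContMDiff I (I.prod 𝓘(ℝ, 𝔤)) ∞ (fun x => TotalSpace.mk' 𝔤 x (toFun x (X x)))

variable (I 𝔤 V) in
/-- A smooth differential 2-form with values in `V`. -/
structure TwoForm where
  /-- the values of the form -/
  toFun : ∀ x : M, TangentSpace I x →L[ℝ] TangentSpace I x →L[ℝ] V x
  alternating : ∀ x X, toFun x X X = 0
  contMDiff : ∀ X Y : Cₛ^∞⟮I; E, (TangentSpace I : M → Type _)⟯,
    ContMDiff I (I.prod 𝓘(ℝ, 𝔤)) ∞ (fun x => TotalSpace.mk' 𝔤 x (toFun x (X x) (Y x)))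

/-- The curvature `R(X, Y)(u) = ∇_X ∇_Y u - ∇_Y ∇_X u - ∇_[X, Y] u` of a covariant derivative
(in Mathlib's argument order `cov u x (X x)` is the value of `∇_X u` at `x`). -/
def curvatureAt (cov : (∀ x : M, V x) → ∀ x : M, TangentSpace I x →L[ℝ] V x)
    (X Y : ∀ x : M, TangentSpace I x) (u : ∀ x : M, V x) (x : M) : V x :=
  cov (fun y => cov u y (Y y)) x (X x) - cov (fun y => cov u y (X y)) x (Y x)
    - cov u x (VectorField.mlieBracket I X Y x)

variable (I 𝔤 V) in
/-- A linear connection on `V`, i.e. a smooth covariant derivative which is a derivation of the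
fibrewise Lie bracket, whose curvature is inner: `R(X, Y)(u) = [Ω(X, Y), u]` for some
differential 2-form `Ω` with values in `V`. -/
structure CouplingConnection extends CovariantDerivative I 𝔤 V where
  contMDiff : ∀ (X : Cₛ^∞⟮I; E, (TangentSpace I : M → Type _)⟯) (u : Cₛ^∞⟮I; 𝔤, V⟯),
    ContMDiff I (I.prod 𝓘(ℝ, 𝔤)) ∞ (fun x => TotalSpace.mk' 𝔤 x (toFun u x (X x)))
  leibniz_lie : ∀ (u v : Cₛ^∞⟮I; 𝔤, V⟯) (x : M) (X : TangentSpace I x),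
    toFun (fun y => ⁅u y, v y⁆) x X = ⁅toFun u x X, v x⁆ + ⁅u x, toFun v x X⁆
  inner_curvature : ∃ Ω : TwoForm I 𝔤 V,
    ∀ (X Y : Cₛ^∞⟮I; E, (TangentSpace I : M → Type _)⟯) (u : Cₛ^∞⟮I; 𝔤, V⟯) (x : M),
      curvatureAt toFun X Y u x = ⁅Ω.toFun x (X x) (Y x), u x⁆

namespace CouplingConnection

/-- Two connections belong to the same class if `∇'_X u = ∇_X u + [l(X), u]` for some smooth bundle
map `l : TM → L`. -/
def Equivalent (c c' : CouplingConnection I 𝔤 V) : Prop :=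
  ∃ l : OneForm I 𝔤 V, ∀ (u : Cₛ^∞⟮I; 𝔤, V⟯) (x : M) (X : TangentSpace I x),
    c'.toFun u x X = c.toFun u x X + ⁅l.toFun x X, u x⁆

variable (I 𝔤 V) in
/-- Equivalence of connections modulo inner derivations. -/
instance setoid : Setoid (CouplingConnection I 𝔤 V) where
  r := Equivalent
  iseqv :=
    { refl := fun c => ⟨⟨fun _ => 0, fun _ => (contMDiff_zeroSection ℝ V)⟩, by simp⟩
      symm := by
        rintro c c' ⟨l, hl⟩
        refine ⟨⟨fun x => -l.toFun x, fun X => (l.contMDiff X).neg_section⟩, fun u x X => ?_⟩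
        rw [hl]
        simp only [neg_apply, neg_lie, add_neg_cancel_right]
      trans := by
        rintro c c' c'' ⟨l, hl⟩ ⟨l', hl'⟩
        refine ⟨⟨fun x => l.toFun x + l'.toFun x, fun X =>
          (l.contMDiff X).add_section (l'.contMDiff X)⟩, fun u x X => ?_⟩
        rw [hl', hl]
        simp [add_assoc] }

end CouplingConnection

variable (I 𝔤 V) in
/-- The set `Coup(L)` of couplings of `V` with the tangent bundle. -/
def Coup := Quotient (CouplingConnection.setoid I 𝔤 V)

/-! ### The glued connection -/

/-- The trivial connection `(∇^{Φ,α}_X v)(x) = φ_α(x) (∂/∂X) (φ_α⁻¹ v)` of a local trivialization at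
points `x` of its base set `U_α` (and zero at the other points). -/
def LieTrivialization.flatDeriv (e : LieTrivialization I 𝔤 V) (v : ∀ x : M, V x) (x : M) :
    TangentSpace I x →L[ℝ] V x :=
  (e.triv.symmL ℝ x).comp (mvfderiv I (fun y => (e.triv ⟨y, v y⟩).2) x)

/-- The glued connection `∇^{Φ,H}_X u = ∑_α ∇^{Φ,α}_X (h_α u)`. -/
def DeltaStructure.glue (Φ : DeltaStructure.{w} I 𝔤 V)
    (h : SmoothPartitionOfUnity Φ.ι I M univ) (u : ∀ x : M, V x) (x : M) :
    TangentSpace I x →L[ℝ] V x :=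
  ∑ᶠ i, (Φ.e i).flatDeriv (fun y => h i y • u y) x

end Bundle

end

noncomputable section

/-! ### The exponential map of a normed algebra -/

section ExpSubmodule

open NormedSpace

variable {𝔸 : Type*} [NormedRing 𝔸] [NormedAlgebra ℝ 𝔸] [CompleteSpace 𝔸]

/-! Let `e` be a trivialization compatible with `Φ` and `f_i` the transition function from `e` to
`φ_i`. Read in `e`, the flat derivative of `φ_i` becomes `d + f_i⁻¹ df_i`, so everything rests on
`f_i⁻¹ df_i` taking values in `ad 𝔤`.

By continuity into `Aut^δ 𝔤`, the smooth map `f_i` stays locally in one coset of `Inn 𝔤`. Since `Inn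
𝔤` may fail to be closed, this does not at once confine its derivative. However, `Inn 𝔤` is the
union over `m` of the sets of words of `m` factors `exp (ad u)`, and the differential of a word at
the value `A` lies in `A * ad 𝔤`. Near `1` these subspaces are the kernels of `dq` for a submersion
`q`, so `q` takes only countably many values on the words there. A continuous map from a connected
neighbourhood to a countable set is constant; hence `q` is constant along `f_i(x)⁻¹ f_i` near `x`,
and the derivative lies in `ad 𝔤` (`mvfderiv_mem_of_eventually_mem_range_expWord`,
`exists_mul_mvfderiv_eq_adCLM`).

A linear section of `ad` turns `f_i⁻¹ df_i` into a smooth `𝔤`-valued form `θ_i`. As `∑ h_i = 1` and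
`∑ dh_i = 0`, the glued connection reads `d + [Θ, ·]` with `Θ = ∑ h_i θ_i` (`coord_glue`). Such an
operator is a derivation by the Jacobi identity, and its curvature is the bracket with `dΘ + [Θ,
Θ]/2` (`curvature_eq_lie`). Equivalent structures give `d + [Θ, ·]` and `d + [Θ', ·]` in the same
trivializations, hence differ by `[Θ' - Θ, ·]`. Local forms are determined only modulo the centre,
but their brackets with sections are global, so averaging with the partition of unity yields global
`Ω` and `l`. -/

lemma contDiff_exp_real {n : WithTop ℕ∞} : ContDiff ℝ n (exp : 𝔸 → 𝔸) :=
  contDiff_iff_contDiffAt.2 fun x => (exp_analytic (𝕂 := ℝ) x).contDiffAt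

lemma exp_neg_mul_exp (x : 𝔸) : exp (-x) * exp x = 1 := by
  let _ : NormedAlgebra ℚ 𝔸 := NormedAlgebra.restrictScalars ℚ ℝ 𝔸
  rw [← exp_add_of_commute (Commute.refl x).neg_left, neg_add_cancel, exp_zero]

lemma exp_mul_exp_neg (x : 𝔸) : exp x * exp (-x) = 1 := by
  simpa using exp_neg_mul_exp (-x)

/-- Duhamel's formula for difference quotients of the exponential map. -/
lemma exp_neg_mul_exp_add_smul (A B : 𝔸) (ε : ℝ) :
    exp (-A) * exp (A + ε • B) - 1 =
      ε • ∫ s in (0 : ℝ)..1, exp (s • (-A)) * B * exp (s • (A + ε • B)) := by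
  -- The generator is placed on the right in the first derivative and on the left in the second, so
  -- the two `A` terms meet and cancel.
  have hd : ∀ s ∈ uIcc (0 : ℝ) 1, HasDerivAt
      (fun s : ℝ => exp (s • (-A)) * exp (s • (A + ε • B)))
      (ε • (exp (s • (-A)) * B * exp (s • (A + ε • B)))) s := by
    intro s _
    refine ((hasDerivAt_exp_smul_const (𝕂 := ℝ) (-A) s).mul
      (hasDerivAt_exp_smul_const' (𝕂 := ℝ) (A + ε • B) s)).congr_deriv ?_
    simp only [mul_neg, neg_mul, add_mul, mul_add, smul_mul_assoc, mul_smul_comm, mul_assoc]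
    abel
  have hc : Continuous (fun s : ℝ => ε • (exp (s • (-A)) * B * exp (s • (A + ε • B)))) := by
    have := (contDiff_exp_real (𝔸 := 𝔸) (n := 0)).continuous
    fun_prop
  have := intervalIntegral.integral_eq_sub_of_hasDerivAt hd (hc.intervalIntegrable 0 1)
  rw [intervalIntegral.integral_smul] at this
  rw [this]
  simp

/-- If `𝔥` is stable under conjugation by `exp A`, `A ∈ 𝔥`, then the logarithmic derivative of the
exponential map along `𝔥` takes values in `𝔥`. -/
lemma exp_neg_mul_fderiv_exp_mem {𝔥 : Submodule ℝ 𝔸} [FiniteDimensional ℝ 𝔥]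
    (hconj : ∀ A ∈ 𝔥, ∀ B ∈ 𝔥, exp (-A) * B * exp A ∈ 𝔥) {A B : 𝔸} (hA : A ∈ 𝔥) (hB : B ∈ 𝔥) :
    exp (-A) * fderiv ℝ exp A B ∈ 𝔥 := by
  have hexp := (contDiff_exp_real (𝔸 := 𝔸) (n := 0)).continuous
  have hcomp : CompleteSpace 𝔥 := FiniteDimensional.complete ℝ 𝔥
  -- For `ε ≠ 0` Duhamel's formula makes `G ε` the difference quotient at `0`. Continuity of `G`
  -- then gives the derivative `G 0`, whose integrand `exp (-sA) * B * exp (sA)` lies in `𝔥`.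
  set G : ℝ → 𝔸 := fun ε => ∫ s in (0 : ℝ)..1, exp (s • (-A)) * B * exp (s • (A + ε • B)) with hG
  have hGc : Continuous G := by
    apply intervalIntegral.continuous_parametric_intervalIntegral_of_continuous' (f := fun ε s =>
      exp (s • (-A)) * B * exp (s • (A + ε • B)))
    simp only [Function.uncurry_def]
    fun_prop
  have h1 : HasDerivAt (fun ε : ℝ => exp (-A) * exp (A + ε • B)) (exp (-A) * fderiv ℝ exp A B) 0 := by
    refine HasDerivAt.const_mul _ ?_
    have hl : HasDerivAt (fun ε : ℝ => A + ε • B) B 0 := by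
      simpa using! ((hasDerivAt_id (0 : ℝ)).smul_const B).const_add A
    have he : HasFDerivAt (exp : 𝔸 → 𝔸) (fderiv ℝ exp A) (A + (0 : ℝ) • B) := by
      rw [zero_smul, add_zero]
      exact ((contDiff_exp_real (n := 1)).differentiable one_ne_zero A).hasFDerivAt
    exact he.comp_hasDerivAt (0 : ℝ) hl
  have h2 : HasDerivAt (fun ε : ℝ => exp (-A) * exp (A + ε • B)) (G 0) 0 := by
    rw [hasDerivAt_iff_tendsto_slope]
    refine (hGc.continuousAt.tendsto.mono_left nhdsWithin_le_nhds).congr' ?_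
    filter_upwards [self_mem_nhdsWithin] with ε hε
    have hε' : ε ≠ 0 := hε
    rw [slope_def_module]
    simp only [zero_smul, add_zero, sub_zero, exp_neg_mul_exp]
    rw [exp_neg_mul_exp_add_smul, smul_smul, inv_mul_cancel₀ hε', one_smul]
  rw [h1.unique h2]
  have hm : ∀ s : ℝ, exp (s • (-A)) * B * exp (s • (A + (0 : ℝ) • B)) ∈ 𝔥 := by
    intro s
    rw [zero_smul, add_zero, smul_neg]
    exact hconj _ (𝔥.smul_mem s hA) _ hB
  -- The integral is formed inside `𝔥`, which is complete because it is finite-dimensional.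
  have hi : ∫ s in (0 : ℝ)..1, exp (s • (-A)) * B * exp (s • (A + (0 : ℝ) • B)) =
      𝔥.subtypeL (∫ s in (0 : ℝ)..1, (⟨_, hm s⟩ : 𝔥)) := by
    rw [← ContinuousLinearMap.intervalIntegral_comp_comm]
    · rfl
    · refine Continuous.intervalIntegrable ?_ _ _
      refine Continuous.subtype_mk ?_ _
      fun_prop
  change (∫ s in (0 : ℝ)..1, exp (s • (-A)) * B * exp (s • (A + (0 : ℝ) • B))) ∈ 𝔥
  rw [hi]
  exact Subtype.coe_prop _

/-- Near `1`, the distribution `g ↦ g * 𝔥` is the kernel of the differential of a submersion. -/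
lemma exists_submersion_ker_eq_mul [FiniteDimensional ℝ 𝔸] (𝔥 : Submodule ℝ 𝔸)
    (hconj : ∀ A ∈ 𝔥, ∀ B ∈ 𝔥, exp (-A) * B * exp A ∈ 𝔥) :
    ∃ (𝔪 : Submodule ℝ 𝔸) (q : 𝔸 → 𝔪) (N : Set 𝔸), IsOpen N ∧ 1 ∈ N ∧ DifferentiableOn ℝ q N ∧
      ∀ g ∈ N, ∀ W, fderiv ℝ q g W = 0 ↔ ∃ C ∈ 𝔥, W = g * C := by
  obtain ⟨𝔪, h𝔪⟩ := Submodule.exists_isCompl 𝔥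
  have hcm : CompleteSpace 𝔪 := FiniteDimensional.complete ℝ 𝔪
  have hch : CompleteSpace 𝔥 := FiniteDimensional.complete ℝ 𝔥
  -- Coordinates near `1`: the slices with fixed `𝔪`-component are tangent to the subspaces `g * 𝔥`,
  -- so `q` will be the first component of the local inverse.
  set Ψ : 𝔪 × 𝔥 → 𝔸 := fun p => (1 + (p.1 : 𝔸)) * exp (p.2 : 𝔸) with hΨ
  have hΨs : ContDiff ℝ 1 Ψ := by
    have h1 : ContDiff ℝ 1 (fun p : 𝔪 × 𝔥 => (p.1 : 𝔸)) := 𝔪.subtypeL.contDiff.comp contDiff_fst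
    have h2 : ContDiff ℝ 1 (fun p : 𝔪 × 𝔥 => (p.2 : 𝔸)) := 𝔥.subtypeL.contDiff.comp contDiff_snd
    exact (contDiff_const.add h1).mul (contDiff_exp_real.comp h2)
  have hΨd : ∀ (p w : 𝔪 × 𝔥), fderiv ℝ Ψ p w =
      (1 + (p.1 : 𝔸)) * fderiv ℝ exp (p.2 : 𝔸) w.2 + (w.1 : 𝔸) * exp (p.2 : 𝔸) := by
    intro p w
    have h1 : HasFDerivAt (fun p : 𝔪 × 𝔥 => 1 + (p.1 : 𝔸))
        (𝔪.subtypeL.comp (ContinuousLinearMap.fst ℝ 𝔪 𝔥)) p :=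
      (𝔪.subtypeL.comp (ContinuousLinearMap.fst ℝ 𝔪 𝔥)).hasFDerivAt.const_add 1
    have h2 : HasFDerivAt (fun p : 𝔪 × 𝔥 => exp (p.2 : 𝔸))
        ((fderiv ℝ exp (p.2 : 𝔸)).comp (𝔥.subtypeL.comp (ContinuousLinearMap.snd ℝ 𝔪 𝔥))) p :=
      HasFDerivAt.comp (g := (exp : 𝔸 → 𝔸)) p
        ((contDiff_exp_real (n := 1)).differentiable one_ne_zero _).hasFDerivAt
        (𝔥.subtypeL.comp (ContinuousLinearMap.snd ℝ 𝔪 𝔥)).hasFDerivAt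
    have h3 : HasFDerivAt Ψ _ p := h1.mul' h2
    rw [h3.fderiv]
    simp
  have hΨ0 : Ψ 0 = 1 := by simp [hΨ]
  let L : (𝔪 × 𝔥) ≃L[ℝ] 𝔸 := (Submodule.prodEquivOfIsCompl 𝔪 𝔥 h𝔪.symm).toContinuousLinearEquiv
  have hΨ' : HasFDerivAt Ψ (L : 𝔪 × 𝔥 →L[ℝ] 𝔸) 0 := by
    have h := (hΨs.differentiable one_ne_zero 0).hasFDerivAt
    have hL : fderiv ℝ Ψ 0 = (L : 𝔪 × 𝔥 →L[ℝ] 𝔸) := by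
      refine ContinuousLinearMap.ext fun w => ?_
      rw [hΨd]
      simp [L, (hasFDerivAt_exp_zero (𝕂 := ℝ) (𝔸 := 𝔸)).fderiv, add_comm]
    rwa [hL] at h
  set e := hΨs.contDiffAt.toOpenPartialHomeomorph Ψ hΨ' one_ne_zero with he
  have hesymm : ContDiffAt ℝ 1 e.symm 1 := by
    rw [← hΨ0]
    exact hΨs.contDiffAt.to_localInverse hΨ' one_ne_zero
  have h1t : (1 : 𝔸) ∈ e.target := by
    rw [← hΨ0]
    exact hΨs.contDiffAt.image_mem_toOpenPartialHomeomorph_target hΨ' one_ne_zero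
  obtain ⟨N, hNsub, hNo, h1N⟩ := eventually_nhds_iff.1
    ((hesymm.eventually (by simp)).and (e.open_target.mem_nhds h1t))
  have hed : ∀ g ∈ N, DifferentiableAt ℝ e.symm g := fun g hg =>
    (hNsub g hg).1.differentiableAt one_ne_zero
  refine ⟨𝔪, fun g => (e.symm g).1, N, hNo, h1N, fun g hg => ?_, fun g hg W => ?_⟩
  · exact (hed g hg).fst.differentiableWithinAt
  have hgt : g ∈ e.target := (hNsub g hg).2
  set p := e.symm g with hp
  have hΨp : Ψ p = g := e.right_inv hgt
  set S := fderiv ℝ e.symm g with hS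
  set T := fderiv ℝ Ψ p with hT
  have hq : fderiv ℝ (fun g => (e.symm g).1) g W = (S W).1 := by
    rw [(hed g hg).hasFDerivAt.fst.fderiv]
    rfl
  have hTS : ∀ W, T (S W) = W := by
    intro W
    have h : HasFDerivAt (fun y => Ψ (e.symm y)) (T.comp S) g :=
      HasFDerivAt.comp (g := Ψ) g (hΨs.differentiable one_ne_zero _).hasFDerivAt
        (hed g hg).hasFDerivAt
    have h' : HasFDerivAt (fun y => Ψ (e.symm y)) (ContinuousLinearMap.id ℝ 𝔸) g := by
      refine (hasFDerivAt_id g).congr_of_eventuallyEq ?_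
      filter_upwards [e.open_target.mem_nhds hgt] with y hy
      exact e.right_inv hy
    exact congrArg (fun A : 𝔸 →L[ℝ] 𝔸 => A W) (h.unique h')
  have hST : ∀ w, S (T w) = w := by
    intro w
    have hps : p ∈ e.source := e.map_target hgt
    have h : HasFDerivAt (fun y => e.symm (Ψ y)) (S.comp T) p := by
      refine HasFDerivAt.comp (g := e.symm) p ?_ (hΨs.differentiable one_ne_zero _).hasFDerivAt
      rw [hΨp]
      exact (hed g hg).hasFDerivAt
    have h' : HasFDerivAt (fun y => e.symm (Ψ y)) (ContinuousLinearMap.id ℝ (𝔪 × 𝔥)) p := by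
      refine (hasFDerivAt_id p).congr_of_eventuallyEq ?_
      filter_upwards [e.open_source.mem_nhds hps] with y hy
      exact e.left_inv hy
    exact congrArg (fun A : 𝔪 × 𝔥 →L[ℝ] 𝔪 × 𝔥 => A w) (h.unique h')
  -- The logarithmic derivative of `exp` at `p.2`. It is injective because `T` is, hence surjective
  -- on the finite-dimensional `𝔥`; thus the slice directions fill all of `g * 𝔥`.
  let t : 𝔥 →ₗ[ℝ] 𝔥 :=
    { toFun := fun k => ⟨exp (-(p.2 : 𝔸)) * fderiv ℝ exp (p.2 : 𝔸) k,
        exp_neg_mul_fderiv_exp_mem hconj p.2.2 k.2⟩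
      map_add' := fun a b => by ext; simp [mul_add]
      map_smul' := fun a b => by ext; simp }
  have hTt : ∀ k : 𝔥, T (0, k) = g * (t k : 𝔸) := by
    intro k
    rw [hT, hΨd, ← hΨp]
    change _ = (1 + (p.1 : 𝔸)) * exp (p.2 : 𝔸) * (exp (-(p.2 : 𝔸)) * fderiv ℝ exp (p.2 : 𝔸) k)
    rw [← mul_assoc, mul_assoc (1 + (p.1 : 𝔸)) _ (exp (-(p.2 : 𝔸))), exp_mul_exp_neg]
    simp
  have htinj : Function.Injective t := by
    intro k k' hk
    have h : T (0, k) = T (0, k') := by rw [hTt, hTt, hk]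
    have := congrArg S h
    rw [hST, hST] at this
    exact (Prod.ext_iff.1 this).2
  rw [hq]
  constructor
  · intro hW
    refine ⟨t (S W).2, (t (S W).2).2, ?_⟩
    rw [← hTt, ← hW]
    exact (hTS W).symm
  · rintro ⟨C, hC, rfl⟩
    obtain ⟨k, hk⟩ := LinearMap.injective_iff_surjective.1 htinj ⟨C, hC⟩
    have : g * C = T (0, k) := by rw [hTt, hk]
    rw [this, hST]

/-- Products of `m` exponentials of elements of the image of `a`. -/
def expWord {P : Type*} (a : P → 𝔸) : (m : ℕ) → (Fin m → P) → 𝔸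
  | 0, _ => 1
  | m + 1, u => expWord a m (fun i => u i.succ) * exp (a (u 0))

/-! ### Words in exponentials have countable image under the submersion. -/

variable {P : Type*} [NormedAddCommGroup P] [NormedSpace ℝ P]

/-- Induction on `m`. The last factor contributes the logarithmic derivative of `exp`; the `C` of
the shorter word has to pass that factor to the right, which conjugates it, and `hconj` keeps it in
`𝔥`. -/
lemma exists_hasFDerivAt_expWord {𝔥 : Submodule ℝ 𝔸} [FiniteDimensional ℝ 𝔥]
    (hconj : ∀ A ∈ 𝔥, ∀ B ∈ 𝔥, exp (-A) * B * exp A ∈ 𝔥) (a : P →L[ℝ] 𝔸) (ha : ∀ v, a v ∈ 𝔥)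
    (m : ℕ) (u : Fin m → P) :
    ∃ D : (Fin m → P) →L[ℝ] 𝔸, HasFDerivAt (expWord a m) D u ∧
      ∀ w, ∃ C ∈ 𝔥, D w = expWord a m u * C := by
  induction m with
  | zero => exact ⟨0, hasFDerivAt_const _ _, fun w => ⟨0, 𝔥.zero_mem, by simp⟩⟩
  | succ m ih =>
    obtain ⟨D, hD, hC⟩ := ih (fun i => u i.succ)
    let τ : (Fin (m + 1) → P) →L[ℝ] (Fin m → P) := ContinuousLinearMap.pi fun i : Fin m =>
      ContinuousLinearMap.proj (R := ℝ) (φ := fun _ : Fin (m + 1) => P) i.succ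
    have h1 : HasFDerivAt (fun u : Fin (m + 1) → P => expWord a m (τ u)) (D.comp τ) u :=
      HasFDerivAt.comp (g := expWord a m) u hD τ.hasFDerivAt
    have h2 : HasFDerivAt (fun u : Fin (m + 1) → P => exp (a (u 0)))
        ((fderiv ℝ exp (a (u 0))).comp (a.comp (ContinuousLinearMap.proj 0))) u :=
      HasFDerivAt.comp (g := (exp : 𝔸 → 𝔸)) u
        ((contDiff_exp_real (n := 1)).differentiable one_ne_zero _).hasFDerivAt
        (a.comp (ContinuousLinearMap.proj (R := ℝ) (φ := fun _ : Fin (m + 1) => P) 0)).hasFDerivAt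
    refine ⟨_, h1.mul' h2, fun w => ?_⟩
    obtain ⟨C, hC𝔥, hCw⟩ := hC (fun i => w i.succ)
    refine ⟨exp (-a (u 0)) * fderiv ℝ exp (a (u 0)) (a (w 0)) + exp (-a (u 0)) * C * exp (a (u 0)),
      𝔥.add_mem (exp_neg_mul_fderiv_exp_mem hconj (ha _) (ha _)) (hconj _ (ha _) _ hC𝔥), ?_⟩
    have hx := exp_mul_exp_neg (a (u 0))
    change expWord a m (fun i => u i.succ) * fderiv ℝ exp (a (u 0)) (a (w 0)) +
      D (fun i => w i.succ) * exp (a (u 0)) = expWord a m (fun i => u i.succ) * exp (a (u 0)) * _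
    rw [hCw]
    simp only [mul_add, mul_assoc]
    congr 1
    · rw [← mul_assoc (exp (a (u 0))), hx, one_mul]
    · rw [← mul_assoc (exp (a (u 0))) (exp (-a (u 0))), hx, one_mul]

/-- The differential of a word takes values in directions killed by `dq`, so `q` of a word is
locally constant on an open subset of `P^m`. By second countability only countably many values
occur. -/
lemma countable_image_expWord {𝔥 : Submodule ℝ 𝔸} [FiniteDimensional ℝ 𝔥]
    (hconj : ∀ A ∈ 𝔥, ∀ B ∈ 𝔥, exp (-A) * B * exp A ∈ 𝔥) [FiniteDimensional ℝ P]
    (a : P →L[ℝ] 𝔸) (ha : ∀ v, a v ∈ 𝔥) {F : Type*} [NormedAddCommGroup F]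
    [NormedSpace ℝ F] {q : 𝔸 → F} {N : Set 𝔸} (hN : IsOpen N) (hq : DifferentiableOn ℝ q N)
    (hker : ∀ g ∈ N, ∀ C ∈ 𝔥, fderiv ℝ q g (g * C) = 0) (m : ℕ) :
    (q '' (range (expWord a m) ∩ N)).Countable := by
  choose D hD hDC using exists_hasFDerivAt_expWord hconj a ha m
  set s := expWord a m ⁻¹' N with hs
  have hcont : Continuous (expWord a m) :=
    continuous_iff_continuousAt.2 fun u => (hD u).continuousAt
  have hso : IsOpen s := hN.preimage hcont
  have hfd : ∀ u ∈ s, HasFDerivAt (q ∘ expWord a m) (0 : (Fin m → P) →L[ℝ] F) u := by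
    intro u hu
    have h := ((hq.differentiableAt (hN.mem_nhds hu)).hasFDerivAt).comp u (hD u)
    have h0 : (fderiv ℝ q (expWord a m u)).comp (D u) = 0 := by
      refine ContinuousLinearMap.ext fun w => ?_
      obtain ⟨C, hC, hw⟩ := hDC u w
      rw [ContinuousLinearMap.comp_apply, hw, hker _ hu _ hC, zero_apply]
    rwa [h0] at h
  have hloc : ∀ u ∈ s, {v | q (expWord a m v) = q (expWord a m u)} ∈ 𝓝[s] u := by
    intro u hu
    obtain ⟨r, hr, hrs⟩ := Metric.isOpen_iff.1 hso u hu
    refine mem_nhdsWithin_of_mem_nhds (Filter.mem_of_superset (Metric.ball_mem_nhds u hr) ?_)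
    intro v hv
    exact Metric.isOpen_ball.is_const_of_fderiv_eq_zero (𝕜 := ℝ) (f := q ∘ expWord a m)
      (convex_ball u r).isPreconnected
      (fun x hx => (hfd x (hrs hx)).differentiableAt.differentiableWithinAt)
      (fun x hx => (hfd x (hrs hx)).fderiv) hv (Metric.mem_ball_self hr)
  have : SecondCountableTopology (Fin m → P) := by
    have : ProperSpace P := FiniteDimensional.proper_real P
    infer_instance
  obtain ⟨t, -, htc, hst⟩ := TopologicalSpace.countable_cover_nhdsWithin hloc
  refine (htc.image (fun u => q (expWord a m u))).mono ?_
  rintro _ ⟨_, ⟨⟨v, rfl⟩, hv⟩, rfl⟩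
  obtain ⟨u, hu, huv⟩ := mem_iUnion₂.1 (hst hv)
  exact ⟨u, hu, huv.symm⟩

/-- A map into the group generated by `exp 𝔥` has its derivative at a point over `1` in `𝔥`. -/
lemma mvfderiv_mem_of_eventually_mem_range_expWord [FiniteDimensional ℝ 𝔸] {𝔥 : Submodule ℝ 𝔸}
    (hconj : ∀ A ∈ 𝔥, ∀ B ∈ 𝔥, exp (-A) * B * exp A ∈ 𝔥)
    [FiniteDimensional ℝ P] (a : P →L[ℝ] 𝔸) (ha : ∀ v, a v ∈ 𝔥)
    {E : Type*} [NormedAddCommGroup E] [NormedSpace ℝ E]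
    {M : Type*} [TopologicalSpace M] [ChartedSpace E M] {f : M → 𝔸} {x : M}
    (hfc : ∀ᶠ y in 𝓝 x, ContinuousAt f y) (hf : MDifferentiableAt 𝓘(ℝ, E) 𝓘(ℝ, 𝔸) f x)
    (hx : f x = 1) (hword : ∀ᶠ y in 𝓝 x, f y ∈ ⋃ m, range (expWord a m))
    (X : TangentSpace 𝓘(ℝ, E) x) : mvfderiv 𝓘(ℝ, E) f x X ∈ 𝔥 := by
  obtain ⟨𝔪, q, N, hNo, h1N, hq, hker⟩ := exists_submersion_ker_eq_mul 𝔥 hconj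
  have hlc : LocallyConnectedSpace M := ChartedSpace.locallyConnectedSpace E M
  have hN : ∀ᶠ y in 𝓝 x, f y ∈ N := hf.continuousAt.eventually_mem (hNo.mem_nhds (hx ▸ h1N))
  obtain ⟨U, ⟨hUo, hxU, hUc⟩, hU⟩ := (LocallyConnectedSpace.open_connected_basis x).mem_iff.1
    (hfc.and (hword.and hN))
  have hcount : (q '' ((⋃ m, range (expWord a m)) ∩ N)).Countable := by
    rw [iUnion_inter, image_iUnion]
    refine countable_iUnion fun m => countable_image_expWord hconj a ha hNo hq (fun g hg C hC => ?_) m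
    exact (hker g hg _).2 ⟨C, hC, rfl⟩
  -- A countable subset of a real normed space is totally disconnected, so the connected image of
  -- `U` is a point. This replaces closedness of the group.
  have hconst : ((q ∘ f) '' U).Subsingleton := by
    refine hcount.isTotallyDisconnected _ ?_ (hUc.isPreconnected.image _ ?_)
    · rintro _ ⟨y, hy, rfl⟩
      exact ⟨f y, ⟨(hU hy).2.1, (hU hy).2.2⟩, rfl⟩
    · intro y hy
      exact ((hq.continuousOn.continuousAt (hNo.mem_nhds (hU hy).2.2)).comp
        (hU hy).1).continuousWithinAt
  have hqd : DifferentiableAt ℝ q (f x) := by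
    rw [hx]
    exact hq.differentiableAt (hNo.mem_nhds h1N)
  have hcomp : HasMFDerivAt 𝓘(ℝ, E) 𝓘(ℝ, 𝔪) (q ∘ f) x
      ((fderiv ℝ q (f x)).comp (mfderiv 𝓘(ℝ, E) 𝓘(ℝ, 𝔸) f x)) :=
    HasMFDerivAt.comp x hqd.hasFDerivAt.hasMFDerivAt hf.hasMFDerivAt
  have hzero : HasMFDerivAt 𝓘(ℝ, E) 𝓘(ℝ, 𝔪) (q ∘ f) x
      (0 : TangentSpace 𝓘(ℝ, E) x →L[ℝ] 𝔪) := by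
    refine (hasMFDerivAt_const (q (f x)) x).congr_of_eventuallyEq ?_
    filter_upwards [hUo.mem_nhds hxU] with y hy
    exact hconst ⟨y, hy, rfl⟩ ⟨x, hxU, rfl⟩
  have h0 : fderiv ℝ q 1 (mvfderiv 𝓘(ℝ, E) f x X) = 0 := by
    have h := congrArg (fun A : TangentSpace 𝓘(ℝ, E) x →L[ℝ] 𝔪 => A X)
      (hasMFDerivAt_unique hcomp hzero)
    rw [← hx]
    exact h
  -- At `g = 1` the kernel `g * 𝔥` is `𝔥` itself.
  obtain ⟨C, hC, h⟩ := (hker 1 h1N _).1 h0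
  rw [h, one_mul]
  exact hC

end ExpSubmodule

/-! ### The adjoint representation -/

section Adjoint

open NormedSpace

variable (𝔤 : Type*) [LieNormedGroup 𝔤] [LieNormedSpace 𝔤] [FiniteDimensional ℝ 𝔤]

/-- The adjoint representation as a continuous linear map. -/
def adCLM : 𝔤 →L[ℝ] 𝔤 →L[ℝ] 𝔤 :=
  LinearMap.toContinuousLinearMap
    ((LinearMap.toContinuousLinearMap : (𝔤 →ₗ[ℝ] 𝔤) ≃ₗ[ℝ] (𝔤 →L[ℝ] 𝔤)).toLinearMap ∘ₗ
      (LieAlgebra.ad ℝ 𝔤 : 𝔤 →ₗ[ℝ] Module.End ℝ 𝔤))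

variable {𝔤}

@[simp] lemma adCLM_apply (u v : 𝔤) : adCLM 𝔤 u v = ⁅u, v⁆ := rfl

/-- Because `A = ad u` is a derivation, `exp (-sA) [exp (sA) x, exp (sA) y]` does not depend on `s`;
compare `s = 1` with `s = 0`. -/
lemma exp_adCLM_lie (u x y : 𝔤) :
    exp (adCLM 𝔤 u) ⁅x, y⁆ = ⁅exp (adCLM 𝔤 u) x, exp (adCLM 𝔤 u) y⁆ := by
  have : CompleteSpace 𝔤 := FiniteDimensional.complete ℝ 𝔤
  set A := adCLM 𝔤 u with hA
  have hE : ∀ (s : ℝ) (z : 𝔤), HasDerivAt (fun s : ℝ => exp (s • A) z) (A (exp (s • A) z)) s := by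
    intro s z
    exact (hasDerivAt_exp_smul_const' (𝕂 := ℝ) A s).clm_apply (hasDerivAt_const s z)
      |>.congr_deriv (by simp)
  have hd : ∀ s : ℝ, HasDerivAt
      (fun s : ℝ => exp (s • (-A)) (adCLM 𝔤 (exp (s • A) x) (exp (s • A) y))) 0 s := by
    intro s
    have h1 : HasDerivAt (fun s : ℝ => adCLM 𝔤 (exp (s • A) x) (exp (s • A) y))
        (adCLM 𝔤 (A (exp (s • A) x)) (exp (s • A) y) +
          adCLM 𝔤 (exp (s • A) x) (A (exp (s • A) y))) s :=
      ((adCLM 𝔤).hasFDerivAt.comp_hasDerivAt s (hE s x)).clm_apply (hE s y)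
    refine ((hasDerivAt_exp_smul_const (𝕂 := ℝ) (-A) s).clm_apply h1).congr_deriv ?_
    have hA' : A ⁅exp (s • A) x, exp (s • A) y⁆ =
        ⁅A (exp (s • A) x), exp (s • A) y⁆ + ⁅exp (s • A) x, A (exp (s • A) y)⁆ := by
      rw [hA]
      simp only [adCLM_apply]
      rw [leibniz_lie]
    simp only [mul_apply_eq_comp, neg_apply, adCLM_apply, hA', map_add,
      map_neg]
    abel
  have hconst := is_const_of_deriv_eq_zero (fun s => (hd s).differentiableAt)
    (fun s => (hd s).deriv) 1 0
  simp only [one_smul, zero_smul, exp_zero, adCLM_apply, one_apply_eq_self] at hconst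
  have h := congrArg (fun z => exp A z) hconst
  rw [← mul_apply_eq_comp, exp_mul_exp_neg] at h
  exact h.symm

/-- Conjugating `ad v` by the automorphism `exp (-ad u)` gives `ad (exp (-ad u) v)`. This is the
hypothesis `hconj` for `𝔥 = ad 𝔤`. -/
lemma exp_neg_adCLM_mul_mul_exp (A : 𝔤 →L[ℝ] 𝔤) (hA : A ∈ LinearMap.range (adCLM 𝔤).toLinearMap)
    (B : 𝔤 →L[ℝ] 𝔤) (hB : B ∈ LinearMap.range (adCLM 𝔤).toLinearMap) :
    exp (-A) * B * exp A ∈ LinearMap.range (adCLM 𝔤).toLinearMap := by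
  have : CompleteSpace 𝔤 := FiniteDimensional.complete ℝ 𝔤
  obtain ⟨u, rfl⟩ := hA
  obtain ⟨v, rfl⟩ := hB
  refine ⟨exp (-adCLM 𝔤 u) v, ?_⟩
  ext w
  have h := exp_adCLM_lie (-u) v (exp (adCLM 𝔤 u) w)
  rw [map_neg, ← mul_apply_eq_comp (exp (-adCLM 𝔤 u)) (exp (adCLM 𝔤 u)),
    exp_neg_mul_exp] at h
  exact h.symm

/-- The inverse of `exp (ad u)` is `exp (ad (-u))`, so words need no inverse letters. -/
lemma AutDelta.toCLM_mem_range_expWord {φ : AutDelta 𝔤} (hφ : φ ∈ AutDelta.inn 𝔤) :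
    φ.toCLM ∈ ⋃ m, range (expWord (adCLM 𝔤) m) := by
  have : CompleteSpace 𝔤 := FiniteDimensional.complete ℝ 𝔤
  have hstep : ∀ (A : 𝔤 →L[ℝ] 𝔤) (u : 𝔤), A ∈ ⋃ m, range (expWord (adCLM 𝔤) m) →
      A * exp (adCLM 𝔤 u) ∈ ⋃ m, range (expWord (adCLM 𝔤) m) := by
    intro A u hA
    obtain ⟨m, v, rfl⟩ := mem_iUnion.1 hA
    exact mem_iUnion.2 ⟨m + 1, Fin.cons u v, rfl⟩
  induction hφ using Subgroup.closure_induction_right with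
  | one => exact mem_iUnion.2 ⟨0, Fin.elim0, rfl⟩
  | mul_right φ hφ ψ hψ ih =>
    obtain ⟨u, hu⟩ := hψ
    rw [AutDelta.toCLM_mul, hu]
    exact hstep _ u ih
  | mul_inv_cancel φ hφ ψ hψ ih =>
    obtain ⟨u, hu⟩ := hψ
    have h : (ψ⁻¹).toCLM = exp (adCLM 𝔤 (-u)) := by
      have h1 : (ψ⁻¹).toCLM * exp (adCLM 𝔤 u) = 1 := by
        rw [show exp (adCLM 𝔤 u) = ψ.toCLM from hu.symm, ← AutDelta.toCLM_mul, inv_mul_cancel,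
          AutDelta.toCLM_one]
      rw [map_neg, ← one_mul (exp (-adCLM 𝔤 u)), ← h1, mul_assoc, exp_mul_exp_neg, mul_one]
    rw [AutDelta.toCLM_mul, h]
    exact hstep _ _ ih

/-- The logarithmic derivative of a map into `Aut 𝔤` which locally stays in one coset of `Inn 𝔤` is
inner. -/
lemma exists_mul_mvfderiv_eq_adCLM {E : Type*} [NormedAddCommGroup E] [NormedSpace ℝ E]
    {M : Type*} [TopologicalSpace M] [ChartedSpace E M] {f : M → 𝔤 →L[ℝ] 𝔤} {x : M}
    (hfc : ∀ᶠ y in 𝓝 x, ContinuousAt f y)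
    (hf : MDifferentiableAt 𝓘(ℝ, E) 𝓘(ℝ, 𝔤 →L[ℝ] 𝔤) f x) (B : 𝔤 →L[ℝ] 𝔤) (hB : B * f x = 1)
    (hinn : ∀ᶠ y in 𝓝 x, ∃ φ ∈ AutDelta.inn 𝔤, B * f y = φ.toCLM) (X : TangentSpace 𝓘(ℝ, E) x) :
    ∃ ξ : 𝔤, B * mvfderiv 𝓘(ℝ, E) f x X = adCLM 𝔤 ξ := by
  have : CompleteSpace 𝔤 := FiniteDimensional.complete ℝ 𝔤
  -- Left multiplication by `B = (f x)⁻¹` moves the coset to `Inn 𝔤` and the base value to `1`.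
  let L : (𝔤 →L[ℝ] 𝔤) →L[ℝ] (𝔤 →L[ℝ] 𝔤) := ContinuousLinearMap.mul ℝ (𝔤 →L[ℝ] 𝔤) B
  have hLf : HasMFDerivAt 𝓘(ℝ, E) 𝓘(ℝ, 𝔤 →L[ℝ] 𝔤) (fun y => B * f y) x
      (L.comp (mvfderiv 𝓘(ℝ, E) f x)) :=
    HasMFDerivAt.comp x (L.hasFDerivAt (x := f x)).hasMFDerivAt hf.hasMFDerivAt
  have h := mvfderiv_mem_of_eventually_mem_range_expWord (f := fun y => B * f y) (x := x)
    exp_neg_adCLM_mul_mul_exp (adCLM 𝔤) (fun v => ⟨v, rfl⟩)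
    (hfc.mono fun y hy => continuousAt_const.mul hy) hLf.mdifferentiableAt hB ?_ X
  · obtain ⟨ξ, hξ⟩ := h
    refine ⟨ξ, ?_⟩
    have h' : mvfderiv 𝓘(ℝ, E) (fun y => B * f y) x X = B * mvfderiv 𝓘(ℝ, E) f x X :=
      congrArg (fun A : TangentSpace 𝓘(ℝ, E) x →L[ℝ] 𝔤 →L[ℝ] 𝔤 => A X) hLf.mfderiv
    rw [← h']
    exact hξ.symm
  · filter_upwards [hinn] with y ⟨φ, hφ, hy⟩
    rw [hy]
    exact AutDelta.toCLM_mem_range_expWord hφ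

variable (𝔤) in
-- A preimage under `ad` is ambiguous by the centre. Choosing it linearly keeps forms smooth.
lemma exists_adCLM_section :
    ∃ σ : (𝔤 →L[ℝ] 𝔤) →L[ℝ] 𝔤, ∀ ξ : 𝔤, adCLM 𝔤 (σ (adCLM 𝔤 ξ)) = adCLM 𝔤 ξ := by
  obtain ⟨s, hs⟩ := (adCLM 𝔤).toLinearMap.rangeRestrict.exists_rightInverse_of_surjective
    (LinearMap.range_rangeRestrict _)
  obtain ⟨t, ht⟩ := s.exists_extend
  refine ⟨LinearMap.toContinuousLinearMap t, fun ξ => ?_⟩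
  have h1 : t (adCLM 𝔤 ξ) = s ⟨adCLM 𝔤 ξ, ξ, rfl⟩ := by rw [← ht]; rfl
  have h2 := congrArg Subtype.val
    (LinearMap.congr_fun hs (⟨adCLM 𝔤 ξ, ξ, rfl⟩ : LinearMap.range (adCLM 𝔤).toLinearMap))
  change adCLM 𝔤 (t (adCLM 𝔤 ξ)) = adCLM 𝔤 ξ
  rw [h1]
  exact h2

end Adjoint

/-! ### Derivatives of vector-valued functions on manifolds -/

section Calculus

variable {E : Type*} [NormedAddCommGroup E] [NormedSpace ℝ E]
  {M : Type*} [TopologicalSpace M] [ChartedSpace E M]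
  {F : Type*} [NormedAddCommGroup F] [NormedSpace ℝ F]
  {G : Type*} [NormedAddCommGroup G] [NormedSpace ℝ G]
  {K : Type*} [NormedAddCommGroup K] [NormedSpace ℝ K]

lemma ContinuousLinearMap.hasMFDerivAt_of_bilinear (B : F →L[ℝ] G →L[ℝ] K) {f : M → F} {g : M → G}
    {x : M} (hf : MDifferentiableAt 𝓘(ℝ, E) 𝓘(ℝ, F) f x)
    (hg : MDifferentiableAt 𝓘(ℝ, E) 𝓘(ℝ, G) g x) :
    HasMFDerivAt 𝓘(ℝ, E) 𝓘(ℝ, K) (fun y => B (f y) (g y)) x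
      ((B.precompR E (f x) (mvfderiv 𝓘(ℝ, E) g x) : E →L[ℝ] K) +
        B.precompL E (mvfderiv 𝓘(ℝ, E) f x) (g x)) := by
  have hc : ContinuousAt (fun y => B (f y) (g y)) x :=
    (B.continuous.continuousAt.comp hf.continuousAt).clm_apply hg.continuousAt
  refine ⟨hc, ?_⟩
  have h := B.hasFDerivWithinAt_of_bilinear hf.hasMFDerivAt.2 hg.hasMFDerivAt.2
  simp only [writtenInExtChartAt, extChartAt_model_space_eq_id, Function.comp_def,
    extChartAt_to_inv] at h ⊢
  exact h

lemma mvfderiv_bilinear (B : F →L[ℝ] G →L[ℝ] K) {f : M → F} {g : M → G}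
    {x : M} (hf : MDifferentiableAt 𝓘(ℝ, E) 𝓘(ℝ, F) f x)
    (hg : MDifferentiableAt 𝓘(ℝ, E) 𝓘(ℝ, G) g x) (X : TangentSpace 𝓘(ℝ, E) x) :
    mvfderiv 𝓘(ℝ, E) (fun y => B (f y) (g y)) x X =
      B (f x) (mvfderiv 𝓘(ℝ, E) g x X) + B (mvfderiv 𝓘(ℝ, E) f x X) (g x) :=
  congrArg (fun A : TangentSpace 𝓘(ℝ, E) x →L[ℝ] K => A X)
    (B.hasMFDerivAt_of_bilinear hf hg).mfderiv

lemma mvfderiv_congr {f g : M → F} {x : M} (h : f =ᶠ[𝓝 x] g) :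
    mvfderiv 𝓘(ℝ, E) f x = mvfderiv 𝓘(ℝ, E) g x := by
  ext X
  have h := congrArg (fun A : TangentSpace 𝓘(ℝ, E) x →L[ℝ] F => A X)
    (h.mfderiv_eq (I := 𝓘(ℝ, E)) (I' := 𝓘(ℝ, F)))
  exact h

/-- Over `fintsupport x` the sum equals `1` on a whole neighbourhood of `x`, so it may be
differentiated. -/
lemma sum_fintsupport_mvfderiv_eq_zero {ι : Type*} (h : SmoothPartitionOfUnity ι 𝓘(ℝ, E) M univ)
    (x : M) (X : TangentSpace 𝓘(ℝ, E) x) :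
    ∑ i ∈ h.fintsupport x, mvfderiv 𝓘(ℝ, E) (h i) x X = 0 := by
  have hd : ∀ i, MDifferentiableAt 𝓘(ℝ, E) 𝓘(ℝ, ℝ) (h i) x := fun i =>
    (h i).contMDiff.contMDiffAt.mdifferentiableAt (by simp)
  have hsum : ∀ s : Finset ι, MDifferentiableAt 𝓘(ℝ, E) 𝓘(ℝ, ℝ) (fun y => ∑ i ∈ s, h i y) x ∧
      mvfderiv 𝓘(ℝ, E) (fun y => ∑ i ∈ s, h i y) x X =
        ∑ i ∈ s, mvfderiv 𝓘(ℝ, E) (h i) x X := by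
    classical
    intro s
    induction s using Finset.induction_on with
    | empty => simpa using ⟨mdifferentiableAt_const, by rw [mvfderiv_const]; rfl⟩
    | insert i s hi ih =>
      simp only [Finset.sum_insert hi]
      refine ⟨(hd i).add ih.1, ?_⟩
      rw [mvfderiv_fun_add (hd i) ih.1, add_apply, ih.2]
  rw [← (hsum _).2]
  have h1 : (fun y => ∑ i ∈ h.fintsupport x, h i y) =ᶠ[𝓝 x] fun _ => (1 : ℝ) := by
    filter_upwards [h.eventually_finsupport_subset x] with y hy
    exact h.sum_finsupport' y (mem_univ y) hy
  rw [mvfderiv_congr h1, mvfderiv_const]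
  rfl

variable [IsManifold 𝓘(ℝ, E) ∞ M]

/-- Joint smoothness in point and vector: composing with a vector field `X` gives smoothness of `X
f`. -/
lemma ContMDiffOn.contMDiffOn_mvfderiv {f : M → F} {U : Set M} (hU : IsOpen U)
    (hf : ContMDiffOn 𝓘(ℝ, E) 𝓘(ℝ, F) ∞ f U) :
    ContMDiffOn 𝓘(ℝ, E).tangent 𝓘(ℝ, F) ∞
      (fun p : TangentBundle 𝓘(ℝ, E) M => mvfderiv 𝓘(ℝ, E) f p.proj p.snd)
      (π E (TangentSpace 𝓘(ℝ, E) : M → Type _) ⁻¹' U) := by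
  have : IsManifold 𝓘(ℝ, E) 1 M := IsManifold.of_le (n := ∞) (by simp)
  have h := hf.contMDiffOn_tangentMapWithin (m := ∞) (by simp) hU.uniqueMDiffOn
  have h2 := (contMDiff_snd_tangentBundle_modelSpace F 𝓘(ℝ, F)
    (n := ∞)).comp_contMDiffOn h
  refine h2.congr fun p hp => ?_
  change _ = mfderivWithin 𝓘(ℝ, E) 𝓘(ℝ, F) f U p.proj p.snd
  rw [mfderivWithin_of_isOpen hU hp]
  rfl

lemma fderiv_comp_extChartAt_symm_mpullbackWithin {f : M → F} {x : M} {z : E}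
    (hz : z ∈ (extChartAt 𝓘(ℝ, E) x).target)
    (hf : MDifferentiableAt 𝓘(ℝ, E) 𝓘(ℝ, F) f ((extChartAt 𝓘(ℝ, E) x).symm z))
    (X : ∀ y : M, TangentSpace 𝓘(ℝ, E) y) :
    fderiv ℝ (f ∘ (extChartAt 𝓘(ℝ, E) x).symm) z
        (VectorField.mpullbackWithin 𝓘(ℝ, E) 𝓘(ℝ, E) (extChartAt 𝓘(ℝ, E) x).symm X
          (range 𝓘(ℝ, E)) z) =
      mvfderiv 𝓘(ℝ, E) f ((extChartAt 𝓘(ℝ, E) x).symm z) (X ((extChartAt 𝓘(ℝ, E) x).symm z)) := by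
  have : IsManifold 𝓘(ℝ, E) 1 M := IsManifold.of_le (n := ∞) (by simp)
  set φ := extChartAt 𝓘(ℝ, E) x with hφ
  have hinv := isInvertible_mfderivWithin_extChartAt_symm (I := 𝓘(ℝ, E)) (x := x) hz
  have hr : range 𝓘(ℝ, E) = univ := 𝓘(ℝ, E).range_eq_univ
  have hd : MDifferentiableAt 𝓘(ℝ, E) 𝓘(ℝ, E) φ.symm z := by
    have := mdifferentiableWithinAt_extChartAt_symm (I := 𝓘(ℝ, E)) (x := x) hz
    rwa [hr, mdifferentiableWithinAt_univ] at this
  rw [hr, mfderivWithin_univ] at hinv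
  rw [hr, VectorField.mpullbackWithin_univ, ← mfderiv_eq_fderiv, VectorField.mpullback_apply]
  have hcomp := mfderiv_comp_apply z hf hd
    ((mfderiv 𝓘(ℝ, E) 𝓘(ℝ, E) φ.symm z).inverse (X (φ.symm z)))
  rw [hinv.self_apply_inverse] at hcomp
  exact hcomp

lemma mdifferentiableAt_mvfderiv {f : M → F} {U : Set M} (hU : IsOpen U)
    (hf : ContMDiffOn 𝓘(ℝ, E) 𝓘(ℝ, F) ∞ f U) {x : M} (hx : x ∈ U)
    {X : ∀ y : M, TangentSpace 𝓘(ℝ, E) y}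
    (hX : MDifferentiableAt 𝓘(ℝ, E) 𝓘(ℝ, E).tangent
      (fun y => (⟨y, X y⟩ : TangentBundle 𝓘(ℝ, E) M)) x) :
    MDifferentiableAt 𝓘(ℝ, E) 𝓘(ℝ, F) (fun y => mvfderiv 𝓘(ℝ, E) f y (X y)) x := by
  have h := (hf.contMDiffOn_mvfderiv hU).contMDiffAt (x := (⟨x, X x⟩ : TangentBundle 𝓘(ℝ, E) M))
    ((hU.preimage (FiberBundle.continuous_proj E _)).mem_nhds hx)
  exact (h.mdifferentiableAt (by simp)).comp x hX

/-- Transported to the chart at `x`, the identity `[X, Y] f = X Y f - Y X f` is the symmetry of the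
second derivative. Smoothness only on `U` is assumed because `f` will be a section read in a
trivialization. -/
lemma mvfderiv_mlieBracket [CompleteSpace E] {f : M → F} {U : Set M} (hU : IsOpen U)
    (hf : ContMDiffOn 𝓘(ℝ, E) 𝓘(ℝ, F) ∞ f U) {x : M} (hx : x ∈ U)
    {X Y : ∀ y : M, TangentSpace 𝓘(ℝ, E) y}
    (hX : MDifferentiableAt 𝓘(ℝ, E) 𝓘(ℝ, E).tangent
      (fun y => (⟨y, X y⟩ : TangentBundle 𝓘(ℝ, E) M)) x)
    (hY : MDifferentiableAt 𝓘(ℝ, E) 𝓘(ℝ, E).tangent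
      (fun y => (⟨y, Y y⟩ : TangentBundle 𝓘(ℝ, E) M)) x) :
    mvfderiv 𝓘(ℝ, E) f x (VectorField.mlieBracket 𝓘(ℝ, E) X Y x) =
      mvfderiv 𝓘(ℝ, E) (fun y => mvfderiv 𝓘(ℝ, E) f y (Y y)) x (X x) -
        mvfderiv 𝓘(ℝ, E) (fun y => mvfderiv 𝓘(ℝ, E) f y (X y)) x (Y x) := by
  have : IsManifold 𝓘(ℝ, E) 1 M := IsManifold.of_le (n := ∞) (by simp)
  have hle : (2 : WithTop ℕ∞) ≤ ∞ := by exact WithTop.coe_le_coe.2 (le_top : (2 : ℕ∞) ≤ ⊤)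
  have : IsManifold 𝓘(ℝ, E) 2 M := IsManifold.of_le (n := ∞) hle
  set φ := extChartAt 𝓘(ℝ, E) x with hφ
  have hr : range 𝓘(ℝ, E) = univ := 𝓘(ℝ, E).range_eq_univ
  have hz : φ x ∈ φ.target := mem_extChartAt_target x
  have hφx : φ.symm (φ x) = x := extChartAt_to_inv x
  have hmd : ∀ y ∈ U, MDifferentiableAt 𝓘(ℝ, E) 𝓘(ℝ, F) f y := fun y hy =>
    (hf.contMDiffAt (hU.mem_nhds hy)).mdifferentiableAt (by simp)
  have hcont : ContinuousAt φ.symm (φ x) := continuousAt_extChartAt_symm x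
  have hnear : ∀ᶠ z in 𝓝 (φ x), z ∈ φ.target ∧ φ.symm z ∈ U :=
    Filter.Eventually.and (extChartAt_target_mem_nhds (I := 𝓘(ℝ, E)) x)
      (hcont.eventually_mem (by rw [hφx]; exact hU.mem_nhds hx))
  have hpull : ∀ Z : ∀ y : M, TangentSpace 𝓘(ℝ, E) y,
      (fun z => fderiv ℝ (f ∘ φ.symm) z
        (VectorField.mpullbackWithin 𝓘(ℝ, E) 𝓘(ℝ, E) φ.symm Z (range 𝓘(ℝ, E)) z)) =ᶠ[𝓝 (φ x)]
        (fun y => mvfderiv 𝓘(ℝ, E) f y (Z y)) ∘ φ.symm := by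
    intro Z
    filter_upwards [hnear] with z hz'
    exact fderiv_comp_extChartAt_symm_mpullbackWithin hz'.1 (hmd _ hz'.2) Z
  have hiter : ∀ Z W : ∀ y : M, TangentSpace 𝓘(ℝ, E) y, MDifferentiableAt 𝓘(ℝ, E)
      𝓘(ℝ, E).tangent (fun y => (⟨y, Z y⟩ : TangentBundle 𝓘(ℝ, E) M)) x →
      fderiv ℝ (fun z => fderiv ℝ (f ∘ φ.symm) z
        (VectorField.mpullbackWithin 𝓘(ℝ, E) 𝓘(ℝ, E) φ.symm Z (range 𝓘(ℝ, E)) z)) (φ x)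
        (VectorField.mpullbackWithin 𝓘(ℝ, E) 𝓘(ℝ, E) φ.symm W (range 𝓘(ℝ, E)) (φ x)) =
      mvfderiv 𝓘(ℝ, E) (fun y => mvfderiv 𝓘(ℝ, E) f y (Z y)) x (W x) := by
    intro Z W hZ
    have hg : MDifferentiableAt 𝓘(ℝ, E) 𝓘(ℝ, F) (fun y => mvfderiv 𝓘(ℝ, E) f y (Z y))
        (φ.symm (φ x)) := by
      rw [hφx]
      exact mdifferentiableAt_mvfderiv hU hf hx hZ
    rw [(hpull Z).fderiv_eq]
    refine (fderiv_comp_extChartAt_symm_mpullbackWithin hz hg W).trans ?_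
    rw [hφx]
  have hfc : ContDiffAt ℝ ∞ (f ∘ φ.symm) (φ x) := by
    rw [← contMDiffAt_iff_contDiffAt]
    refine ContMDiffAt.comp (φ x) (I' := 𝓘(ℝ, E)) ?_ ?_
    · rw [hφx]
      exact hf.contMDiffAt (hU.mem_nhds hx)
    · exact (contMDiffOn_extChartAt_symm x).contMDiffAt (extChartAt_target_mem_nhds x)
  have hdiff : ∀ Z : ∀ y : M, TangentSpace 𝓘(ℝ, E) y, MDifferentiableAt 𝓘(ℝ, E)
      𝓘(ℝ, E).tangent (fun y => (⟨y, Z y⟩ : TangentBundle 𝓘(ℝ, E) M)) x →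
      DifferentiableAt ℝ
        (VectorField.mpullbackWithin 𝓘(ℝ, E) 𝓘(ℝ, E) φ.symm Z (range 𝓘(ℝ, E))) (φ x) := by
    intro Z hZ
    have h := (mdifferentiableWithinAt_univ.2
      hZ).differentiableWithinAt_mpullbackWithin_vectorField
    rw [preimage_univ, univ_inter, ← hφ] at h
    exact h.differentiableAt (by rw [hr]; exact Filter.univ_mem)
  have key := VectorField.fderiv_apply_lieBracket hfc (by simpa using hle) (hdiff Y hY) (hdiff X hX)
  rw [hiter Y X hY, hiter X Y hX] at key
  have hinv := isInvertible_mfderiv_extChartAt (I := 𝓘(ℝ, E))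
    (mem_extChartAt_source (I := 𝓘(ℝ, E)) x)
  have hfφ : f =ᶠ[𝓝 x] (f ∘ φ.symm) ∘ φ := by
    filter_upwards [extChartAt_source_mem_nhds (I := 𝓘(ℝ, E)) x] with y hy
    simp only [Function.comp_apply]
    rw [φ.left_inv hy]
  have hchart : ∀ w : E, mvfderiv 𝓘(ℝ, E) f x ((mfderiv 𝓘(ℝ, E) 𝓘(ℝ, E) φ x).inverse w) =
      fderiv ℝ (f ∘ φ.symm) (φ x) w := by
    intro w
    rw [mvfderiv_congr hfφ]
    have hcomp := mfderiv_comp_apply x (I' := 𝓘(ℝ, E)) (I'' := 𝓘(ℝ, F)) (f := φ)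
      (g := f ∘ φ.symm)
      (hfc.contMDiffAt.mdifferentiableAt (by simp))
      (mdifferentiableAt_extChartAt (mem_chart_source E x))
      ((mfderiv 𝓘(ℝ, E) 𝓘(ℝ, E) φ x).inverse w)
    refine hcomp.trans ?_
    rw [mfderiv_eq_fderiv]
    exact congrArg (fderiv ℝ (f ∘ φ.symm) (φ x)) (hinv.self_apply_inverse w)
  have hbr : ∀ A B : E → E, VectorField.lieBracketWithin ℝ A B (φ.symm ⁻¹' univ ∩ range 𝓘(ℝ, E)) =
      VectorField.lieBracket ℝ A B := by
    intro A B
    rw [hr, preimage_univ, univ_inter, VectorField.lieBracketWithin_univ]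
  rw [← key, ← hchart]
  exact congrArg (fun w : E => mvfderiv 𝓘(ℝ, E) f x
    ((mfderiv 𝓘(ℝ, E) 𝓘(ℝ, E) φ x).inverse w)) (congrFun (hbr _ _) (φ x))

end Calculus

section LocalForm

variable {E : Type u₁} [NormedAddCommGroup E] [NormedSpace ℝ E]
  {M : Type u₃} [TopologicalSpace M] [ChartedSpace E M]
  {𝔤 : Type u₄} [LieNormedGroup 𝔤] [LieNormedSpace 𝔤]
  {V : M → Type u₅} [TopologicalSpace (TotalSpace 𝔤 V)]
  [∀ x, LieRing (V x)] [∀ x, LieAlgebra ℝ (V x)] [∀ x, TopologicalSpace (V x)]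
  [FiberBundle 𝔤 V]

/-! ### Sections in a local trivialization -/

namespace LieTrivialization

/-- The isomorphism `φ(x)⁻¹ : V x → 𝔤` given by a local trivialization, extended by zero. -/
def coord (e : LieTrivialization 𝓘(ℝ, E) 𝔤 V) (x : M) : V x →L[ℝ] 𝔤 :=
  e.triv.continuousLinearMapAt ℝ x

/-- The isomorphism `φ(x) : 𝔤 → V x` given by a local trivialization, extended by zero. -/
def coordSymm (e : LieTrivialization 𝓘(ℝ, E) 𝔤 V) (x : M) : 𝔤 →L[ℝ] V x :=
  e.triv.symmL ℝ x

variable (e e' : LieTrivialization 𝓘(ℝ, E) 𝔤 V) {x : M}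

lemma coord_apply (hx : x ∈ e.triv.baseSet) (v : V x) : e.coord x v = (e.triv ⟨x, v⟩).2 :=
  Trivialization.continuousLinearMapAt_apply_of_mem ℝ e.triv hx v

lemma coordSymm_coord (hx : x ∈ e.triv.baseSet) (v : V x) : e.coordSymm x (e.coord x v) = v :=
  e.triv.symmL_continuousLinearMapAt hx v

lemma coord_coordSymm (hx : x ∈ e.triv.baseSet) (v : 𝔤) : e.coord x (e.coordSymm x v) = v :=
  e.triv.continuousLinearMapAt_symmL hx v

lemma coordSymm_of_notMem (hx : x ∉ e.triv.baseSet) : e.coordSymm x = 0 :=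
  ContinuousLinearMap.ext fun v => e.triv.symmL_apply_of_notMem hx v

lemma coord_injective (hx : x ∈ e.triv.baseSet) : Function.Injective (e.coord x) :=
  Function.LeftInverse.injective (g := e.coordSymm x) (e.coordSymm_coord hx)

lemma coord_lie (hx : x ∈ e.triv.baseSet) (v v' : V x) :
    e.coord x ⁅v, v'⁆ = ⁅e.coord x v, e.coord x v'⁆ := by
  simp only [e.coord_apply hx]
  exact e.map_lie x hx v v'

lemma baseSet_mem_nhds (hx : x ∈ e.triv.baseSet) : e.triv.baseSet ∈ 𝓝 x :=
  e.triv.open_baseSet.mem_nhds hx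

lemma triv_mk_eventuallyEq (hx : x ∈ e.triv.baseSet) (u : ∀ y, V y) :
    (fun y => (e.triv ⟨y, u y⟩).2) =ᶠ[𝓝 x] fun y => e.coord y (u y) := by
  filter_upwards [e.baseSet_mem_nhds hx] with y hy
  exact (e.coord_apply hy _).symm

lemma contMDiffAt_coord (hx : x ∈ e.triv.baseSet) {u : ∀ y, V y}
    (hu : ContMDiffAt 𝓘(ℝ, E) (𝓘(ℝ, E).prod 𝓘(ℝ, 𝔤)) ∞ (fun y => TotalSpace.mk' 𝔤 y (u y)) x) :
    ContMDiffAt 𝓘(ℝ, E) 𝓘(ℝ, 𝔤) ∞ (fun y => e.coord y (u y)) x := by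
  have he : ContMDiffAt (𝓘(ℝ, E).prod 𝓘(ℝ, 𝔤)) (𝓘(ℝ, E).prod 𝓘(ℝ, 𝔤)) ∞ e.triv
      (TotalSpace.mk' 𝔤 x (u x)) :=
    e.contMDiffOn.contMDiffAt (e.triv.open_source.mem_nhds (e.triv.mem_source.2 hx))
  exact (contMDiffAt_snd.comp x (he.comp x hu)).congr_of_eventuallyEq
    (e.triv_mk_eventuallyEq hx u).symm

lemma mdifferentiableAt_coord (hx : x ∈ e.triv.baseSet) {u : ∀ y, V y}
    (hu : MDifferentiableAt 𝓘(ℝ, E) (𝓘(ℝ, E).prod 𝓘(ℝ, 𝔤)) (fun y => TotalSpace.mk' 𝔤 y (u y)) x) :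
    MDifferentiableAt 𝓘(ℝ, E) 𝓘(ℝ, 𝔤) (fun y => e.coord y (u y)) x := by
  have he : ContMDiffAt (𝓘(ℝ, E).prod 𝓘(ℝ, 𝔤)) (𝓘(ℝ, E).prod 𝓘(ℝ, 𝔤)) ∞ e.triv
      (TotalSpace.mk' 𝔤 x (u x)) :=
    e.contMDiffOn.contMDiffAt (e.triv.open_source.mem_nhds (e.triv.mem_source.2 hx))
  exact (mdifferentiableAt_snd.comp x
    ((he.mdifferentiableAt (by simp)).comp x hu)).congr_of_eventuallyEq
    (e.triv_mk_eventuallyEq hx u).symm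

lemma contMDiffAt_mk_coordSymm (hx : x ∈ e.triv.baseSet) {w : M → 𝔤}
    (hw : ContMDiffAt 𝓘(ℝ, E) 𝓘(ℝ, 𝔤) ∞ w x) :
    ContMDiffAt 𝓘(ℝ, E) (𝓘(ℝ, E).prod 𝓘(ℝ, 𝔤)) ∞
      (fun y => TotalSpace.mk' 𝔤 y (e.coordSymm y (w y))) x := by
  have he : ContMDiffAt (𝓘(ℝ, E).prod 𝓘(ℝ, 𝔤)) (𝓘(ℝ, E).prod 𝓘(ℝ, 𝔤)) ∞
      e.triv.toOpenPartialHomeomorph.symm (x, w x) :=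
    e.contMDiffOn_symm.contMDiffAt (e.triv.open_target.mem_nhds (e.triv.mem_target.2 hx))
  refine (he.comp x (contMDiffAt_id.prodMk hw)).congr_of_eventuallyEq ?_
  filter_upwards [e.baseSet_mem_nhds hx] with y hy
  refine Eq.trans ?_ (e.triv.mk_symm hy (w y))
  change TotalSpace.mk' 𝔤 y (e.triv.symmL ℝ y (w y)) = _
  rw [e.triv.symmL_apply hy]

lemma contMDiffAt_of_coord (hx : x ∈ e.triv.baseSet) {u : ∀ y, V y}
    (hu : ContMDiffAt 𝓘(ℝ, E) 𝓘(ℝ, 𝔤) ∞ (fun y => e.coord y (u y)) x) :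
    ContMDiffAt 𝓘(ℝ, E) (𝓘(ℝ, E).prod 𝓘(ℝ, 𝔤)) ∞ (fun y => TotalSpace.mk' 𝔤 y (u y)) x := by
  refine (e.contMDiffAt_mk_coordSymm hx hu).congr_of_eventuallyEq ?_
  filter_upwards [e.baseSet_mem_nhds hx] with y hy
  rw [e.coordSymm_coord hy]

/-- Inside the base set the section vanishes near `x`; outside it `φ(x)` is zero by convention.
Hence the sum in `glue` is finite. -/
lemma flatDeriv_smul_of_notMem_tsupport {ρ : M → ℝ} (hx : x ∉ tsupport ρ) (u : ∀ y, V y) :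
    e.flatDeriv (fun y => ρ y • u y) x = 0 := by
  by_cases hxe : x ∈ e.triv.baseSet
  · have h0 : (fun y => (e.triv ⟨y, ρ y • u y⟩).2) =ᶠ[𝓝 x] fun _ => (0 : 𝔤) := by
      filter_upwards [e.baseSet_mem_nhds hxe, notMem_tsupport_iff_eventuallyEq.1 hx] with y hy hρ
      rw [← e.coord_apply hy, hρ, Pi.zero_apply, zero_smul, map_zero]
    rw [flatDeriv, mvfderiv_congr h0, mvfderiv_const, ContinuousLinearMap.comp_zero]
  · change (e.coordSymm x).comp _ = 0
    rw [e.coordSymm_of_notMem hxe, ContinuousLinearMap.zero_comp]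

/-! ### Transition functions -/

/-- The transition function `φ'(x)⁻¹ ∘ φ(x)` as a function on `M`. -/
def transitionCLM (x : M) : 𝔤 →L[ℝ] 𝔤 := (e'.coord x).comp (e.coordSymm x)

variable {e e'}

lemma transitionCLM_coord (hx : x ∈ e.triv.baseSet) (v : V x) :
    e.transitionCLM e' x (e.coord x v) = e'.coord x v := by
  simp [transitionCLM, e.coordSymm_coord hx]

lemma transitionCLM_mul_transitionCLM (hx : x ∈ e.triv.baseSet) (hx' : x ∈ e'.triv.baseSet) :
    e'.transitionCLM e x * e.transitionCLM e' x = 1 := by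
  ext v
  change e.coord x (e'.coordSymm x (e'.coord x (e.coordSymm x v))) = v
  rw [e'.coordSymm_coord hx', e.coord_coordSymm hx]

variable [FiniteDimensional ℝ 𝔤]

lemma transitionCLM_eq_toCLM (x : ↥(e.triv.baseSet ∩ e'.triv.baseSet)) :
    e.transitionCLM e' x = (e.transition e' x).toCLM := by
  ext v
  change e'.coord x (e.triv.symmL ℝ x v) = (e'.triv ⟨x, e.triv.symm x v⟩).2
  rw [e'.coord_apply x.2.2, e.triv.symmL_apply x.2.1]

lemma contMDiffOn_transitionCLM :
    ContMDiffOn 𝓘(ℝ, E) 𝓘(ℝ, 𝔤 →L[ℝ] 𝔤) ∞ (e.transitionCLM e')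
      (e.triv.baseSet ∩ e'.triv.baseSet) := by
  rintro x ⟨hx, hx'⟩
  refine ContMDiffAt.contMDiffWithinAt ?_
  -- An operator-valued map is smooth once its values on a basis are; these are constant sections of
  -- `e` read in `e'`.
  let b := Module.finBasis ℝ 𝔤
  have hsum : e.transitionCLM e' = fun y => ∑ i, ContinuousLinearMap.smulRightL ℝ 𝔤 𝔤
      (LinearMap.toContinuousLinearMap (b.coord i)) (e.transitionCLM e' y (b i)) := by
    funext y
    refine ContinuousLinearMap.coe_injective (b.ext fun j => ?_)
    simp [Finsupp.single_apply]
  rw [hsum]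
  refine ContMDiffAt.sum fun i _ => ?_
  have h : ContMDiffAt 𝓘(ℝ, E) 𝓘(ℝ, 𝔤) ∞ (fun y => e.transitionCLM e' y (b i)) x :=
    e'.contMDiffAt_coord hx' (e.contMDiffAt_mk_coordSymm hx contMDiffAt_const)
  exact (ContinuousLinearMap.contMDiff _).contMDiffAt.comp x h

/-- Only the discrete part of the topology of `Aut^δ 𝔤` enters; smoothness of the transition
function comes from the trivializations. -/
lemma eventually_transitionCLM_mem_inn (h : Continuous (e.transition e'))
    (hx : x ∈ e.triv.baseSet) (hx' : x ∈ e'.triv.baseSet) :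
    ∀ᶠ y in 𝓝 x, ∃ φ ∈ AutDelta.inn 𝔤,
      e'.transitionCLM e x * e.transitionCLM e' y = φ.toCLM := by
  have ho : IsOpen (e.triv.baseSet ∩ e'.triv.baseSet) :=
    e.triv.open_baseSet.inter e'.triv.open_baseSet
  have hc := (AutDelta.continuousAt_iff.1 (h.continuousAt (x := ⟨x, hx, hx'⟩))).2
  have hm := ho.isOpenEmbedding_subtypeVal.map_nhds_eq ⟨x, hx, hx'⟩
  dsimp only at hm
  rw [← hm, Filter.eventually_map]
  filter_upwards [hc] with y hy
  refine ⟨(e.transition e' ⟨x, hx, hx'⟩)⁻¹ * e.transition e' y, QuotientGroup.eq.1 hy.symm, ?_⟩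
  rw [AutDelta.toCLM_mul, transitionCLM_eq_toCLM y, ← e.transition_inv e' x hx hx',
    ← transitionCLM_eq_toCLM ⟨x, hx', hx⟩]

/-- A `𝔤`-valued form `θ` with `ad θ = f⁻¹ df`, where `f` is the transition function. -/
def logDeriv (e e' : LieTrivialization 𝓘(ℝ, E) 𝔤 V) (x : M) : TangentSpace 𝓘(ℝ, E) x →L[ℝ] 𝔤 :=
  (exists_adCLM_section 𝔤).choose.comp
    ((ContinuousLinearMap.mul ℝ (𝔤 →L[ℝ] 𝔤) (e'.transitionCLM e x)).comp
      (mvfderiv 𝓘(ℝ, E) (e.transitionCLM e') x))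

lemma mdifferentiableAt_transitionCLM (hx : x ∈ e.triv.baseSet) (hx' : x ∈ e'.triv.baseSet) :
    MDifferentiableAt 𝓘(ℝ, E) 𝓘(ℝ, 𝔤 →L[ℝ] 𝔤) (e.transitionCLM e') x :=
  (contMDiffOn_transitionCLM.contMDiffAt
    ((e.triv.open_baseSet.inter e'.triv.open_baseSet).mem_nhds ⟨hx, hx'⟩)).mdifferentiableAt
    (by simp)

/-- The chosen section inverts `ad` only on `ad 𝔤`; `exists_mul_mvfderiv_eq_adCLM` places `f⁻¹ df`
there. -/
lemma adCLM_logDeriv (h : Continuous (e.transition e'))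
    (hx : x ∈ e.triv.baseSet) (hx' : x ∈ e'.triv.baseSet) (X : TangentSpace 𝓘(ℝ, E) x) :
    adCLM 𝔤 (e.logDeriv e' x X) =
      e'.transitionCLM e x * mvfderiv 𝓘(ℝ, E) (e.transitionCLM e') x X := by
  have ho : IsOpen (e.triv.baseSet ∩ e'.triv.baseSet) :=
    e.triv.open_baseSet.inter e'.triv.open_baseSet
  obtain ⟨ξ, hξ⟩ := exists_mul_mvfderiv_eq_adCLM (f := e.transitionCLM e') (x := x)
    (by
      filter_upwards [ho.mem_nhds ⟨hx, hx'⟩] with y hy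
      exact (contMDiffOn_transitionCLM.contMDiffAt (ho.mem_nhds hy)).continuousAt)
    (mdifferentiableAt_transitionCLM hx hx') (e'.transitionCLM e x)
    (transitionCLM_mul_transitionCLM hx hx') (eventually_transitionCLM_mem_inn h hx hx') X
  have hσ := (exists_adCLM_section 𝔤).choose_spec ξ
  rw [← hξ] at hσ
  exact hσ

lemma contMDiffOn_logDeriv [IsManifold 𝓘(ℝ, E) ∞ M] :
    ContMDiffOn 𝓘(ℝ, E).tangent 𝓘(ℝ, 𝔤) ∞
      (fun p : TangentBundle 𝓘(ℝ, E) M => e.logDeriv e' p.proj p.snd)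
      (π E (TangentSpace 𝓘(ℝ, E) : M → Type _) ⁻¹' (e.triv.baseSet ∩ e'.triv.baseSet)) := by
  have : IsManifold 𝓘(ℝ, E) 1 M := IsManifold.of_le (n := ∞) (by simp)
  have ho : IsOpen (e.triv.baseSet ∩ e'.triv.baseSet) :=
    e.triv.open_baseSet.inter e'.triv.open_baseSet
  have h1 := (contMDiffOn_transitionCLM (e := e) (e' := e')).contMDiffOn_mvfderiv ho
  have h2 : ContMDiffOn 𝓘(ℝ, E).tangent 𝓘(ℝ, 𝔤 →L[ℝ] 𝔤) ∞
      (fun p : TangentBundle 𝓘(ℝ, E) M => e'.transitionCLM e p.proj)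
      (π E (TangentSpace 𝓘(ℝ, E) : M → Type _) ⁻¹' (e.triv.baseSet ∩ e'.triv.baseSet)) :=
    (contMDiffOn_transitionCLM (e := e') (e' := e)).comp
      (contMDiff_proj (TangentSpace 𝓘(ℝ, E) : M → Type _)).contMDiffOn fun p hp => ⟨hp.2, hp.1⟩
  exact ((exists_adCLM_section 𝔤).choose.contMDiff (n := ∞)).comp_contMDiffOn (h2.clm_comp h1)

end LieTrivialization

end LocalForm

section GluedConnection

variable {E : Type u₁} [NormedAddCommGroup E] [NormedSpace ℝ E]
  {M : Type u₃} [TopologicalSpace M] [ChartedSpace E M]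
  {𝔤 : Type u₄} [LieNormedGroup 𝔤] [LieNormedSpace 𝔤] [FiniteDimensional ℝ 𝔤]
  {V : M → Type u₅} [TopologicalSpace (TotalSpace 𝔤 V)]
  [∀ x, LieRing (V x)] [∀ x, LieAlgebra ℝ (V x)] [∀ x, TopologicalSpace (V x)]
  [FiberBundle 𝔤 V]

/-! ### The glued connection in a local trivialization -/

namespace DeltaStructure

variable (Φ : DeltaStructure.{w} 𝓘(ℝ, E) 𝔤 V) (h : SmoothPartitionOfUnity Φ.ι 𝓘(ℝ, E) M univ)
  (e : LieTrivialization 𝓘(ℝ, E) 𝔤 V)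

/-- The connection form of the glued connection with respect to a local trivialization. -/
def connForm (x : M) : TangentSpace 𝓘(ℝ, E) x →L[ℝ] 𝔤 :=
  ∑ᶠ i, h i x • e.logDeriv (Φ.e i) x

variable {Φ h e}

lemma connForm_eq_sum {x : M} {s : Finset Φ.ι} (hs : h.finsupport x ⊆ s) :
    Φ.connForm h e x = ∑ i ∈ s, h i x • e.logDeriv (Φ.e i) x := by
  refine finsum_eq_sum_of_support_subset _ fun i hi => ?_
  refine hs ((h.mem_finsupport x).2 ?_)
  intro h0
  exact hi (by simp only [h0, zero_smul])

lemma connForm_apply (x : M) (X : TangentSpace 𝓘(ℝ, E) x) :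
    Φ.connForm h e x X = ∑ᶠ i, h i x • e.logDeriv (Φ.e i) x X := by
  rw [connForm_eq_sum subset_rfl]
  rw [finsum_eq_sum_of_support_subset (s := h.finsupport x)]
  · simp
  · intro i hi
    refine (h.mem_finsupport x).2 ?_
    intro h0
    exact hi (by simp only [h0, zero_smul])

end DeltaStructure

namespace LieTrivialization

variable {e e' : LieTrivialization 𝓘(ℝ, E) 𝔤 V} {x : M}

/-- The `e'`-coordinate of a section is `f` times its `e`-coordinate; differentiating and applying
`f⁻¹` turns `d` into `d + f⁻¹ df`. -/
lemma coord_flatDeriv_smul (he : Continuous (e.transition e')) (hx : x ∈ e.triv.baseSet)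
    (hx' : x ∈ e'.triv.baseSet) {ρ : M → ℝ} (hρ : MDifferentiableAt 𝓘(ℝ, E) 𝓘(ℝ, ℝ) ρ x)
    {u : ∀ y, V y}
    (hu : MDifferentiableAt 𝓘(ℝ, E) (𝓘(ℝ, E).prod 𝓘(ℝ, 𝔤)) (fun y => TotalSpace.mk' 𝔤 y (u y)) x)
    (X : TangentSpace 𝓘(ℝ, E) x) :
    e.coord x (e'.flatDeriv (fun y => ρ y • u y) x X) =
      mvfderiv 𝓘(ℝ, E) ρ x X • e.coord x (u x) +
        ρ x • (mvfderiv 𝓘(ℝ, E) (fun y => e.coord y (u y)) x X +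
          ⁅e.logDeriv e' x X, e.coord x (u x)⁆) := by
  have hf := mdifferentiableAt_transitionCLM hx hx'
  have hc := e.mdifferentiableAt_coord hx hu
  -- The identity of `𝔤 →L[ℝ] 𝔤` serves as the bilinear evaluation pairing, so that the bilinear
  -- product rule applies.
  have h1 : (fun y => (e'.triv ⟨y, ρ y • u y⟩).2) =ᶠ[𝓝 x]
      fun y => ρ y • (ContinuousLinearMap.id ℝ (𝔤 →L[ℝ] 𝔤)) (e.transitionCLM e' y)
        (e.coord y (u y)) := by
    filter_upwards [e.baseSet_mem_nhds hx, e'.baseSet_mem_nhds hx'] with y hy hy'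
    rw [← e'.coord_apply hy', map_smul, ContinuousLinearMap.id_apply, transitionCLM_coord hy]
  have h2 : MDifferentiableAt 𝓘(ℝ, E) 𝓘(ℝ, 𝔤)
      (fun y => (ContinuousLinearMap.id ℝ (𝔤 →L[ℝ] 𝔤)) (e.transitionCLM e' y)
        (e.coord y (u y))) x :=
    ((ContinuousLinearMap.id ℝ (𝔤 →L[ℝ] 𝔤)).hasMFDerivAt_of_bilinear hf hc).mdifferentiableAt
  change e'.transitionCLM e x (mvfderiv 𝓘(ℝ, E) (fun y => (e'.triv ⟨y, ρ y • u y⟩).2) x X) = _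
  rw [mvfderiv_congr h1, mvfderiv_fun_smul hρ h2]
  have h3 := mvfderiv_bilinear (ContinuousLinearMap.id ℝ (𝔤 →L[ℝ] 𝔤)) hf hc X
  have hinv : ∀ v, e'.transitionCLM e x (e.transitionCLM e' x v) = v := fun v =>
    congrArg (fun A : 𝔤 →L[ℝ] 𝔤 => A v) (transitionCLM_mul_transitionCLM hx hx')
  have had := congrArg (fun A : 𝔤 →L[ℝ] 𝔤 => A (e.coord x (u x))) (adCLM_logDeriv he hx hx' X)
  simp only [adCLM_apply, mul_apply_eq_comp] at had
  rw [add_apply, smul_apply, h3]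
  simp only [ContinuousLinearMap.id_apply, ContinuousLinearMap.smulRight_apply, map_add, map_smul,
    hinv, had]
  abel

end LieTrivialization

namespace DeltaStructure

variable {Φ : DeltaStructure.{w} 𝓘(ℝ, E) 𝔤 V} {h : SmoothPartitionOfUnity Φ.ι 𝓘(ℝ, E) M univ}
  {e : LieTrivialization 𝓘(ℝ, E) 𝔤 V}

variable [∀ x, IsTopologicalAddGroup (V x)] in
/-- In a trivialization compatible with `Φ`, the glued connection is `d + [Θ, ·]`. -/
lemma coord_glue (he : ∀ i, Continuous (e.transition (Φ.e i))) (hsub : h.IsSubordinate Φ.U)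
    {x : M} (hx : x ∈ e.triv.baseSet) {u : ∀ y, V y}
    (hu : MDifferentiableAt 𝓘(ℝ, E) (𝓘(ℝ, E).prod 𝓘(ℝ, 𝔤)) (fun y => TotalSpace.mk' 𝔤 y (u y)) x)
    (X : TangentSpace 𝓘(ℝ, E) x) :
    e.coord x (Φ.glue h u x X) =
      mvfderiv 𝓘(ℝ, E) (fun y => e.coord y (u y)) x X +
        ⁅Φ.connForm h e x X, e.coord x (u x)⁆ := by
  -- The index set is `fintsupport`, since `h i` may vanish at `x` without vanishing near `x`.
  have hglue : Φ.glue h u x =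
      ∑ i ∈ h.fintsupport x, (Φ.e i).flatDeriv (fun y => h i y • u y) x := by
    refine finsum_eq_sum_of_support_subset _ fun i hi => ?_
    refine (h.mem_fintsupport_iff x i).2 ?_
    by_contra hn
    exact hi (LieTrivialization.flatDeriv_smul_of_notMem_tsupport _ hn u)
  have hterm : ∀ i ∈ h.fintsupport x,
      e.coord x ((Φ.e i).flatDeriv (fun y => h i y • u y) x X) =
      mvfderiv 𝓘(ℝ, E) (h i) x X • e.coord x (u x) +
        h i x • (mvfderiv 𝓘(ℝ, E) (fun y => e.coord y (u y)) x X +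
          ⁅e.logDeriv (Φ.e i) x X, e.coord x (u x)⁆) := fun i hi =>
    LieTrivialization.coord_flatDeriv_smul (he i) hx (hsub i ((h.mem_fintsupport_iff x i).1 hi))
      ((h i).contMDiff.contMDiffAt.mdifferentiableAt (by simp)) hu X
  have h1 : ∑ i ∈ h.fintsupport x, h i x = 1 :=
    h.sum_finsupport' x (mem_univ x) (h.finsupport_subset_fintsupport x)
  rw [hglue, sum_apply, map_sum, Finset.sum_congr rfl hterm,
    Finset.sum_add_distrib, ← Finset.sum_smul, sum_fintsupport_mvfderiv_eq_zero, zero_smul,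
    zero_add]
  simp only [smul_add]
  rw [Finset.sum_add_distrib, ← Finset.sum_smul, h1, one_smul,
    connForm_eq_sum (h.finsupport_subset_fintsupport x), sum_apply,
    ← adCLM_apply, map_sum, sum_apply]
  simp

variable [IsManifold 𝓘(ℝ, E) ∞ M]

lemma contMDiffOn_connForm (hsub : h.IsSubordinate Φ.U) :
    ContMDiffOn 𝓘(ℝ, E).tangent 𝓘(ℝ, 𝔤) ∞
      (fun p : TangentBundle 𝓘(ℝ, E) M => Φ.connForm h e p.proj p.snd)
      (π E (TangentSpace 𝓘(ℝ, E) : M → Type _) ⁻¹' e.triv.baseSet) := by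
  have : IsManifold 𝓘(ℝ, E) 1 M := IsManifold.of_le (n := ∞) (by simp)
  have hproj : Continuous (π E (TangentSpace 𝓘(ℝ, E) : M → Type _)) :=
    FiberBundle.continuous_proj E _
  intro p hp
  refine ContMDiffAt.contMDiffWithinAt ?_
  simp only [connForm_apply]
  refine _root_.contMDiffAt_finsum ?_ fun i => ?_
  · refine (h.locallyFinite.preimage_continuous hproj).subset fun i q hq => ?_
    intro h0
    refine hq ?_
    change h i q.proj = 0 at h0
    simp only [h0, zero_smul]
  · by_cases hi : p.proj ∈ tsupport (h i)
    · have h1 : ContMDiffAt 𝓘(ℝ, E).tangent 𝓘(ℝ, ℝ) ∞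
          (fun q : TangentBundle 𝓘(ℝ, E) M => h i q.proj) p :=
        (h i).contMDiff.contMDiffAt.comp p (contMDiffAt_proj (TangentSpace 𝓘(ℝ, E) : M → Type _))
      refine h1.smul (LieTrivialization.contMDiffOn_logDeriv.contMDiffAt ?_)
      exact ((e.triv.open_baseSet.inter (Φ.e i).triv.open_baseSet).preimage hproj).mem_nhds
        ⟨hp, hsub i hi⟩
    · refine (contMDiffAt_const (c := (0 : 𝔤))).congr_of_eventuallyEq ?_
      have hn : ∀ᶠ y in 𝓝 p.proj, h i y = 0 := notMem_tsupport_iff_eventuallyEq.1 hi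
      filter_upwards [hproj.continuousAt.eventually hn] with q hq
      change h i q.proj = 0 at hq
      rw [hq, zero_smul]

end DeltaStructure

end GluedConnection

/-! ### The curvature of a connection form -/

section CurvatureForm

variable {E : Type u₁} [NormedAddCommGroup E] [NormedSpace ℝ E]
  {M : Type u₃} [TopologicalSpace M] [ChartedSpace E M]
  {𝔤 : Type u₄} [LieNormedGroup 𝔤] [LieNormedSpace 𝔤]

/-- The expression `X Θ(Y) - Y Θ(X) - Θ([X, Y]) + [Θ(X), Θ(Y)]`. -/
def curvatureExpr (Θ : ∀ x : M, TangentSpace 𝓘(ℝ, E) x →L[ℝ] 𝔤) (x : M)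
    (X Y : ∀ y : M, TangentSpace 𝓘(ℝ, E) y) : 𝔤 :=
  mvfderiv 𝓘(ℝ, E) (fun y => Θ y (Y y)) x (X x) - mvfderiv 𝓘(ℝ, E) (fun y => Θ y (X y)) x (Y x)
    - Θ x (VectorField.mlieBracket 𝓘(ℝ, E) X Y x) + ⁅Θ x (X x), Θ x (Y x)⁆

lemma curvatureExpr_self (Θ : ∀ x : M, TangentSpace 𝓘(ℝ, E) x →L[ℝ] 𝔤) (x : M)
    (X : ∀ y : M, TangentSpace 𝓘(ℝ, E) y) : curvatureExpr Θ x X X = 0 := by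
  simp [curvatureExpr]

lemma curvatureExpr_swap (Θ : ∀ x : M, TangentSpace 𝓘(ℝ, E) x →L[ℝ] 𝔤) (x : M)
    (X Y : ∀ y : M, TangentSpace 𝓘(ℝ, E) y) :
    curvatureExpr Θ x X Y = -curvatureExpr Θ x Y X := by
  simp only [curvatureExpr]
  rw [VectorField.mlieBracket_swap_apply, map_neg, ← lie_skew]
  abel

variable [IsManifold 𝓘(ℝ, E) ∞ M]

/-- Smoothness of a one-form with values in a vector space, as a function on the tangent bundle. -/
def IsSmoothFormOn (Θ : ∀ x : M, TangentSpace 𝓘(ℝ, E) x →L[ℝ] 𝔤) (U : Set M) : Prop :=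
  ContMDiffOn 𝓘(ℝ, E).tangent 𝓘(ℝ, 𝔤) ∞
    (fun p : TangentBundle 𝓘(ℝ, E) M => Θ p.proj p.snd)
    (π E (TangentSpace 𝓘(ℝ, E) : M → Type _) ⁻¹' U)

namespace IsSmoothFormOn

variable {Θ : ∀ x : M, TangentSpace 𝓘(ℝ, E) x →L[ℝ] 𝔤} {U : Set M} {x : M}
  {X Y : ∀ y : M, TangentSpace 𝓘(ℝ, E) y}

lemma contMDiffAt (hΘ : IsSmoothFormOn Θ U) (hU : IsOpen U) (hx : x ∈ U)
    (hX : ContMDiffAt 𝓘(ℝ, E) 𝓘(ℝ, E).tangent ∞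
      (fun y => (⟨y, X y⟩ : TangentBundle 𝓘(ℝ, E) M)) x) :
    ContMDiffAt 𝓘(ℝ, E) 𝓘(ℝ, 𝔤) ∞ (fun y => Θ y (X y)) x :=
  (ContMDiffOn.contMDiffAt (x := (⟨x, X x⟩ : TangentBundle 𝓘(ℝ, E) M)) hΘ
    ((hU.preimage (FiberBundle.continuous_proj E _)).mem_nhds hx)).comp x hX

lemma mdifferentiableAt (hΘ : IsSmoothFormOn Θ U) (hU : IsOpen U) (hx : x ∈ U)
    (hX : MDifferentiableAt 𝓘(ℝ, E) 𝓘(ℝ, E).tangent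
      (fun y => (⟨y, X y⟩ : TangentBundle 𝓘(ℝ, E) M)) x) :
    MDifferentiableAt 𝓘(ℝ, E) 𝓘(ℝ, 𝔤) (fun y => Θ y (X y)) x :=
  ((ContMDiffOn.contMDiffAt (x := (⟨x, X x⟩ : TangentBundle 𝓘(ℝ, E) M)) hΘ
    ((hU.preimage (FiberBundle.continuous_proj E _)).mem_nhds hx)).mdifferentiableAt
    (by simp)).comp x hX

/-- For `f X` in place of `X`, the term `-Y(f) Θ(X)` from `Y Θ(f X)` cancels against the one from
`[f X, Y]`. -/
lemma tensorialAt_curvatureExpr [CompleteSpace E] (hΘ : IsSmoothFormOn Θ U) (hU : IsOpen U)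
    (hx : x ∈ U) :
    TensorialAt 𝓘(ℝ, E) E (fun X => curvatureExpr Θ x X Y) x where
  smul {f X} hf hX := by
    have : IsManifold 𝓘(ℝ, E) 2 M :=
      IsManifold.of_le (n := ∞) (WithTop.coe_le_coe.2 (le_top : (2 : ℕ∞) ≤ ⊤))
    have h1 : (fun y => Θ y ((f • X) y)) = fun y => f y • Θ y (X y) := by
      funext y
      exact map_smul (Θ y) (f y) (X y)
    simp only [curvatureExpr]
    rw [h1, mvfderiv_fun_smul hf (hΘ.mdifferentiableAt hU hx hX),
      VectorField.mlieBracket_smul_left hf hX]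
    simp only [Pi.smul_apply', map_smul, map_add, add_apply, smul_apply,
      ContinuousLinearMap.smulRight_apply, smul_lie, smul_add, smul_sub, neg_smul, map_neg]
    abel
  add {X X'} hX hX' := by
    have : IsManifold 𝓘(ℝ, E) 2 M :=
      IsManifold.of_le (n := ∞) (WithTop.coe_le_coe.2 (le_top : (2 : ℕ∞) ≤ ⊤))
    have h1 : (fun y => Θ y ((X + X') y)) = fun y => Θ y (X y) + Θ y (X' y) := by
      funext y
      exact map_add (Θ y) (X y) (X' y)
    simp only [curvatureExpr]
    rw [h1, mvfderiv_fun_add (hΘ.mdifferentiableAt hU hx hX) (hΘ.mdifferentiableAt hU hx hX'),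
      VectorField.mlieBracket_add_left hX hX']
    simp only [Pi.add_apply, map_add, add_apply, add_lie]
    abel

/-- Antisymmetry carries tensoriality over to the second argument, so the expression depends on
point values only. The value `0` off `U` is a mere default. -/
lemma exists_curvatureForm [FiniteDimensional ℝ E] (hΘ : IsSmoothFormOn Θ U) (hU : IsOpen U) :
    ∃ Ω : ∀ x : M, TangentSpace 𝓘(ℝ, E) x →L[ℝ] TangentSpace 𝓘(ℝ, E) x →L[ℝ] 𝔤,
      (∀ x v, Ω x v v = 0) ∧ ∀ x ∈ U, ∀ X Y : ∀ y : M, TangentSpace 𝓘(ℝ, E) y,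
        MDifferentiableAt 𝓘(ℝ, E) 𝓘(ℝ, E).tangent
          (fun y => (⟨y, X y⟩ : TangentBundle 𝓘(ℝ, E) M)) x →
        MDifferentiableAt 𝓘(ℝ, E) 𝓘(ℝ, E).tangent
          (fun y => (⟨y, Y y⟩ : TangentBundle 𝓘(ℝ, E) M)) x →
        Ω x (X x) (Y x) = curvatureExpr Θ x X Y := by
  classical
  have : CompleteSpace E := FiniteDimensional.complete ℝ E
  have : IsManifold 𝓘(ℝ, E) 1 M := IsManifold.of_le (n := ∞) (by simp)
  have : IsManifold 𝓘(ℝ, E) (1 + 1) M := IsManifold.of_le (n := ∞)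
    (WithTop.coe_le_coe.2 (le_top : (1 + 1 : ℕ∞) ≤ ⊤))
  have h1 : ∀ x ∈ U, ∀ Y : ∀ y : M, TangentSpace 𝓘(ℝ, E) y,
      MDifferentiableAt 𝓘(ℝ, E) 𝓘(ℝ, E).tangent
        (fun y => (⟨y, Y y⟩ : TangentBundle 𝓘(ℝ, E) M)) x →
      TensorialAt 𝓘(ℝ, E) E (fun X => curvatureExpr Θ x X Y) x := fun x hx _ _ =>
    hΘ.tensorialAt_curvatureExpr hU hx
  have h2 : ∀ x ∈ U, ∀ X : ∀ y : M, TangentSpace 𝓘(ℝ, E) y,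
      MDifferentiableAt 𝓘(ℝ, E) 𝓘(ℝ, E).tangent
        (fun y => (⟨y, X y⟩ : TangentBundle 𝓘(ℝ, E) M)) x →
      TensorialAt 𝓘(ℝ, E) E (fun Y => curvatureExpr Θ x X Y) x := by
    intro x hx X hX
    refine ⟨fun {f Y} hf hY => ?_, fun {Y Y'} hY hY' => ?_⟩
    · rw [curvatureExpr_swap, (h1 x hx X hX).smul hf hY, curvatureExpr_swap Θ x X Y, smul_neg]
    · rw [curvatureExpr_swap, (h1 x hx X hX).add hY hY', curvatureExpr_swap Θ x X Y,
        curvatureExpr_swap Θ x X Y', neg_add]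
  refine ⟨fun x => if hx : x ∈ U then
    TensorialAt.mkHom₂ (curvatureExpr Θ x) x (h1 x hx) (h2 x hx) else 0, fun x v => ?_,
    fun x hx X Y hX hY => ?_⟩
  · by_cases hx : x ∈ U
    · simp only [dif_pos hx]
      rw [TensorialAt.mkHom₂_apply_eq_extend, curvatureExpr_self]
    · simp only [dif_neg hx]
      rfl
  · simp only [dif_pos hx]
    exact TensorialAt.mkHom₂_apply (h1 x hx) (h2 x hx) hX hY

lemma contMDiffAt_curvatureExpr [FiniteDimensional ℝ E] [FiniteDimensional ℝ 𝔤]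
    (hΘ : IsSmoothFormOn Θ U) (hU : IsOpen U)
    (hx : x ∈ U)
    (hX : ContMDiff 𝓘(ℝ, E) 𝓘(ℝ, E).tangent ∞ (fun y => (⟨y, X y⟩ : TangentBundle 𝓘(ℝ, E) M)))
    (hY : ContMDiff 𝓘(ℝ, E) 𝓘(ℝ, E).tangent ∞ (fun y => (⟨y, Y y⟩ : TangentBundle 𝓘(ℝ, E) M))) :
    ContMDiffAt 𝓘(ℝ, E) 𝓘(ℝ, 𝔤) ∞ (fun y => curvatureExpr Θ y X Y) x := by
  have : CompleteSpace E := FiniteDimensional.complete ℝ E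
  have hd : ∀ Z W : ∀ y : M, TangentSpace 𝓘(ℝ, E) y,
      ContMDiff 𝓘(ℝ, E) 𝓘(ℝ, E).tangent ∞ (fun y => (⟨y, Z y⟩ : TangentBundle 𝓘(ℝ, E) M)) →
      ContMDiff 𝓘(ℝ, E) 𝓘(ℝ, E).tangent ∞ (fun y => (⟨y, W y⟩ : TangentBundle 𝓘(ℝ, E) M)) →
      ContMDiffAt 𝓘(ℝ, E) 𝓘(ℝ, 𝔤) ∞
        (fun y => mvfderiv 𝓘(ℝ, E) (fun z => Θ z (Z z)) y (W y)) x := by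
    intro Z W hZ hW
    have h : ContMDiffOn 𝓘(ℝ, E) 𝓘(ℝ, 𝔤) ∞ (fun z => Θ z (Z z)) U := fun y hy =>
      (hΘ.contMDiffAt hU hy hZ.contMDiffAt).contMDiffWithinAt
    exact ((h.contMDiffOn_mvfderiv hU).contMDiffAt (x := (⟨x, W x⟩ : TangentBundle 𝓘(ℝ, E) M))
      ((hU.preimage (FiberBundle.continuous_proj E _)).mem_nhds hx)).comp x hW.contMDiffAt
  have hbr : ContMDiffAt 𝓘(ℝ, E) 𝓘(ℝ, E).tangent ∞
      (fun y => (⟨y, VectorField.mlieBracket 𝓘(ℝ, E) X Y y⟩ : TangentBundle 𝓘(ℝ, E) M)) x := by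
    have : IsManifold 𝓘(ℝ, E) (((⊤ : ℕ∞) : WithTop ℕ∞) + 1) M := by simpa
    have : IsManifold 𝓘(ℝ, E) (minSmoothness ℝ 2) M := IsManifold.of_le (n := ∞)
      (by simpa using WithTop.coe_le_coe.2 (le_top : (2 : ℕ∞) ≤ ⊤))
    exact ContMDiffAt.mlieBracket_vectorField (m := ⊤) (n := ⊤) hX.contMDiffAt hY.contMDiffAt
      (by simp)
  have h4 : ContMDiffAt 𝓘(ℝ, E) 𝓘(ℝ, 𝔤) ∞ (fun y => adCLM 𝔤 (Θ y (X y)) (Θ y (Y y))) x :=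
    ((adCLM 𝔤).contMDiff.contMDiffAt.comp x (hΘ.contMDiffAt hU hx hX.contMDiffAt)).clm_apply
      (hΘ.contMDiffAt hU hx hY.contMDiffAt)
  exact (((hd Y X hY hX).sub (hd X Y hX hY)).sub (hΘ.contMDiffAt hU hx hbr)).add h4

/-- The curvature of `d + [Θ, ·]`, applied to a function `u`. -/
lemma curvature_eq_lie [CompleteSpace E] [FiniteDimensional ℝ 𝔤] (hΘ : IsSmoothFormOn Θ U)
    (hU : IsOpen U) (hx : x ∈ U)
    (hX : MDifferentiableAt 𝓘(ℝ, E) 𝓘(ℝ, E).tangent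
      (fun y => (⟨y, X y⟩ : TangentBundle 𝓘(ℝ, E) M)) x)
    (hY : MDifferentiableAt 𝓘(ℝ, E) 𝓘(ℝ, E).tangent
      (fun y => (⟨y, Y y⟩ : TangentBundle 𝓘(ℝ, E) M)) x)
    {u : M → 𝔤} (hu : ContMDiffOn 𝓘(ℝ, E) 𝓘(ℝ, 𝔤) ∞ u U) :
    (mvfderiv 𝓘(ℝ, E) (fun y => mvfderiv 𝓘(ℝ, E) u y (Y y) + ⁅Θ y (Y y), u y⁆) x (X x) +
        ⁅Θ x (X x), mvfderiv 𝓘(ℝ, E) u x (Y x) + ⁅Θ x (Y x), u x⁆⁆) -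
      (mvfderiv 𝓘(ℝ, E) (fun y => mvfderiv 𝓘(ℝ, E) u y (X y) + ⁅Θ y (X y), u y⁆) x (Y x) +
        ⁅Θ x (Y x), mvfderiv 𝓘(ℝ, E) u x (X x) + ⁅Θ x (X x), u x⁆⁆) -
      (mvfderiv 𝓘(ℝ, E) u x (VectorField.mlieBracket 𝓘(ℝ, E) X Y x) +
        ⁅Θ x (VectorField.mlieBracket 𝓘(ℝ, E) X Y x), u x⁆) =
      ⁅curvatureExpr Θ x X Y, u x⁆ := by
  have hux : MDifferentiableAt 𝓘(ℝ, E) 𝓘(ℝ, 𝔤) u x :=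
    (hu.contMDiffAt (hU.mem_nhds hx)).mdifferentiableAt (by simp)
  have hd : ∀ Z : ∀ y : M, TangentSpace 𝓘(ℝ, E) y, MDifferentiableAt 𝓘(ℝ, E) 𝓘(ℝ, E).tangent
      (fun y => (⟨y, Z y⟩ : TangentBundle 𝓘(ℝ, E) M)) x → ∀ v : TangentSpace 𝓘(ℝ, E) x,
      mvfderiv 𝓘(ℝ, E) (fun y => mvfderiv 𝓘(ℝ, E) u y (Z y) + ⁅Θ y (Z y), u y⁆) x v =
        mvfderiv 𝓘(ℝ, E) (fun y => mvfderiv 𝓘(ℝ, E) u y (Z y)) x v +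
          (⁅Θ x (Z x), mvfderiv 𝓘(ℝ, E) u x v⁆ +
            ⁅mvfderiv 𝓘(ℝ, E) (fun y => Θ y (Z y)) x v, u x⁆) := by
    intro Z hZ v
    have h1 := mdifferentiableAt_mvfderiv hU hu hx hZ
    have h2 := hΘ.mdifferentiableAt hU hx hZ
    have h3 := ((adCLM 𝔤).hasMFDerivAt_of_bilinear h2 hux).mdifferentiableAt
    have h4 := mvfderiv_bilinear (adCLM 𝔤) h2 hux v
    simp only [adCLM_apply] at h3 h4
    rw [mvfderiv_fun_add h1 h3, add_apply, h4]
  -- The second derivatives of `u` cancel against the bracket term, the mixed terms cancel in pairs,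
  -- and the Jacobi identity combines the two double brackets.
  rw [hd Y hY, hd X hX, mvfderiv_mlieBracket hU hu hx hX hY, curvatureExpr]
  have hj : ⁅⁅Θ x (X x), Θ x (Y x)⁆, u x⁆ =
      ⁅Θ x (X x), ⁅Θ x (Y x), u x⁆⁆ - ⁅Θ x (Y x), ⁅Θ x (X x), u x⁆⁆ := lie_lie _ _ _
  simp only [add_lie, sub_lie, lie_add, hj]
  abel

end IsSmoothFormOn

end CurvatureForm

/-! ### Gluing with a partition of unity -/

namespace SmoothPartitionOfUnity

variable {ι : Type*} {E : Type*} [NormedAddCommGroup E] [NormedSpace ℝ E]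
  {M : Type*} [TopologicalSpace M] [ChartedSpace E M]

lemma finsum_smul_eq_sum {A : Type*} [AddCommGroup A] [Module ℝ A]
    (h : SmoothPartitionOfUnity ι 𝓘(ℝ, E) M univ) (x : M) (a : ι → A) :
    ∑ᶠ i, h i x • a i = ∑ i ∈ h.finsupport x, h i x • a i := by
  refine finsum_eq_sum_of_support_subset _ fun i hi => (h.mem_finsupport x).2 fun h0 => ?_
  exact hi (by simp only [h0, zero_smul])

lemma finsum_smul_lie {L : Type*} [LieRing L] [LieAlgebra ℝ L]
    (h : SmoothPartitionOfUnity ι 𝓘(ℝ, E) M univ) (x : M) (a : ι → L) (b : L) :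
    ⁅∑ᶠ i, h i x • a i, b⁆ = ∑ᶠ i, h i x • ⁅a i, b⁆ := by
  simp [finsum_smul_eq_sum, sum_lie]

/-- Applied to brackets of local forms with a section: these agree on overlaps even where the forms
do not. -/
lemma finsum_smul_eq_of_forall {A : Type*} [AddCommGroup A] [Module ℝ A]
    {h : SmoothPartitionOfUnity ι 𝓘(ℝ, E) M univ} {U : ι → Set M} (hsub : h.IsSubordinate U)
    {x : M} {a : ι → A} {b : A} (ha : ∀ i, x ∈ U i → a i = b) : ∑ᶠ i, h i x • a i = b := by
  have h1 : ∑ i ∈ h.finsupport x, h i x = 1 := h.sum_finsupport x (mem_univ x)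
  rw [finsum_smul_eq_sum, Finset.sum_congr rfl (g := fun i => h i x • b), ← Finset.sum_smul, h1,
    one_smul]
  intro i hi
  rw [ha i (hsub i (subset_tsupport _ ((h.mem_finsupport x).1 hi)))]

lemma contMDiff_finsum_smul_section {F : Type*} [NormedAddCommGroup F] [NormedSpace ℝ F]
    {V : M → Type*} [TopologicalSpace (TotalSpace F V)] [∀ x, AddCommGroup (V x)]
    [∀ x, Module ℝ (V x)] [∀ x, TopologicalSpace (V x)] [FiberBundle F V] [VectorBundle ℝ F V]
    {h : SmoothPartitionOfUnity ι 𝓘(ℝ, E) M univ} {U : ι → Set M} (hsub : h.IsSubordinate U)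
    {s : ι → ∀ x, V x}
    (hs : ∀ i, ∀ x ∈ U i, ContMDiffAt 𝓘(ℝ, E) (𝓘(ℝ, E).prod 𝓘(ℝ, F)) ∞
      (fun y => TotalSpace.mk' F y (s i y)) x) :
    ContMDiff 𝓘(ℝ, E) (𝓘(ℝ, E).prod 𝓘(ℝ, F)) ∞
      (fun x => TotalSpace.mk' F x (∑ᶠ i, h i x • s i x)) := by
  refine ContMDiff.finsum_section_of_locallyFinite (t := fun i x => h i x • s i x)
    (h.locallyFinite.subset fun i x hx h0 => hx ?_) fun i x => ?_
  · simp only [h0, zero_smul]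
  · by_cases hi : x ∈ tsupport (h i)
    · exact (h i).contMDiff.contMDiffAt.smul_section (hs i x (hsub i hi))
    · refine ((contMDiff_zeroSection ℝ V).contMDiffAt (x := x)).congr_of_eventuallyEq ?_
      filter_upwards [notMem_tsupport_iff_eventuallyEq.1 hi] with y hy
      rw [hy]
      simp [zeroSection]

end SmoothPartitionOfUnity

/-! ### Global properties of the glued connection. -/

section GluedConnection

variable {E : Type u₁} [NormedAddCommGroup E] [NormedSpace ℝ E]
  {M : Type u₃} [TopologicalSpace M] [ChartedSpace E M]
  {𝔤 : Type u₄} [LieNormedGroup 𝔤] [LieNormedSpace 𝔤] [FiniteDimensional ℝ 𝔤]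
  {V : M → Type u₅} [TopologicalSpace (TotalSpace 𝔤 V)]
  [∀ x, LieRing (V x)] [∀ x, LieAlgebra ℝ (V x)] [∀ x, TopologicalSpace (V x)]
  [FiberBundle 𝔤 V]

namespace DeltaStructure

variable {Φ : DeltaStructure.{w} 𝓘(ℝ, E) 𝔤 V} {h : SmoothPartitionOfUnity Φ.ι 𝓘(ℝ, E) M univ}

variable (Φ) in
lemma exists_isSubordinate [FiniteDimensional ℝ E] [IsManifold 𝓘(ℝ, E) ∞ M] [T2Space M]
    [SigmaCompactSpace M] :
    ∃ h : SmoothPartitionOfUnity Φ.ι 𝓘(ℝ, E) M univ, h.IsSubordinate Φ.U :=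
  SmoothPartitionOfUnity.exists_isSubordinate 𝓘(ℝ, E) isClosed_univ Φ.U
    (fun i => (Φ.e i).triv.open_baseSet) fun x _ => mem_iUnion.2 (Φ.cover x)

lemma isSmoothFormOn_connForm [IsManifold 𝓘(ℝ, E) ∞ M] (hsub : h.IsSubordinate Φ.U)
    (e : LieTrivialization 𝓘(ℝ, E) 𝔤 V) :
    IsSmoothFormOn (Φ.connForm h e) e.triv.baseSet :=
  contMDiffOn_connForm hsub

variable [∀ x, IsTopologicalAddGroup (V x)]

/-- Locally `d` obeys the product rule for the bracket, and `[Θ, ·]` is a derivation by the Jacobi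
identity. -/
lemma glue_lie (hsub : h.IsSubordinate Φ.U) {x : M} {u v : ∀ y, V y}
    (hu : ContMDiff 𝓘(ℝ, E) (𝓘(ℝ, E).prod 𝓘(ℝ, 𝔤)) ∞ (fun y => TotalSpace.mk' 𝔤 y (u y)))
    (hv : ContMDiff 𝓘(ℝ, E) (𝓘(ℝ, E).prod 𝓘(ℝ, 𝔤)) ∞ (fun y => TotalSpace.mk' 𝔤 y (v y)))
    (X : TangentSpace 𝓘(ℝ, E) x) :
    Φ.glue h (fun y => ⁅u y, v y⁆) x X = ⁅Φ.glue h u x X, v x⁆ + ⁅u x, Φ.glue h v x X⁆ := by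
  obtain ⟨i, hx⟩ := Φ.cover x
  have he := Φ.continuous_transition i
  have hu' := hu.contMDiffAt (x := x)
  have hv' := hv.contMDiffAt (x := x)
  have hcu := (Φ.e i).contMDiffAt_coord hx hu'
  have hcv := (Φ.e i).contMDiffAt_coord hx hv'
  have heq : (fun y => (Φ.e i).coord y ⁅u y, v y⁆) =ᶠ[𝓝 x]
      fun y => adCLM 𝔤 ((Φ.e i).coord y (u y)) ((Φ.e i).coord y (v y)) := by
    filter_upwards [(Φ.e i).baseSet_mem_nhds hx] with y hy
    rw [(Φ.e i).coord_lie hy, adCLM_apply]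
  have huv : ContMDiffAt 𝓘(ℝ, E) (𝓘(ℝ, E).prod 𝓘(ℝ, 𝔤)) ∞
      (fun y => TotalSpace.mk' 𝔤 y ⁅u y, v y⁆) x :=
    (Φ.e i).contMDiffAt_of_coord hx
      ((((adCLM 𝔤).contMDiff.contMDiffAt.comp x hcu).clm_apply hcv).congr_of_eventuallyEq heq)
  apply (Φ.e i).coord_injective hx
  rw [map_add, (Φ.e i).coord_lie hx, (Φ.e i).coord_lie hx,
    coord_glue he hsub hx (huv.mdifferentiableAt (by simp)),
    coord_glue he hsub hx (hu'.mdifferentiableAt (by simp)),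
    coord_glue he hsub hx (hv'.mdifferentiableAt (by simp)), mvfderiv_congr heq,
    mvfderiv_bilinear (adCLM 𝔤) (hcu.mdifferentiableAt (by simp))
      (hcv.mdifferentiableAt (by simp)), (Φ.e i).coord_lie hx]
  simp only [adCLM_apply, add_lie, lie_add]
  rw [leibniz_lie (Φ.connForm h (Φ.e i) x X)]
  abel

lemma isCovariantDerivativeOn_glue [∀ x, ContinuousSMul ℝ (V x)] [VectorBundle ℝ 𝔤 V]
    (hsub : h.IsSubordinate Φ.U) :
    IsCovariantDerivativeOn 𝔤 (Φ.glue h) univ where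
  add {σ σ' x} hσ hσ' _ := by
    obtain ⟨i, hx⟩ := Φ.cover x
    have he := Φ.continuous_transition i
    ext X
    apply (Φ.e i).coord_injective hx
    have heq : (fun y => (Φ.e i).coord y ((σ + σ') y)) =
        fun y => (Φ.e i).coord y (σ y) + (Φ.e i).coord y (σ' y) := by
      funext y
      exact map_add _ _ _
    rw [add_apply, map_add, coord_glue he hsub hx hσ, coord_glue he hsub hx hσ',
      coord_glue he hsub hx (mdifferentiableAt_add_section hσ hσ'), heq,
      mvfderiv_fun_add ((Φ.e i).mdifferentiableAt_coord hx hσ)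
        ((Φ.e i).mdifferentiableAt_coord hx hσ')]
    simp only [add_apply, Pi.add_apply, map_add, lie_add]
    abel
  leibniz {σ g x} hσ hg _ := by
    obtain ⟨i, hx⟩ := Φ.cover x
    have he := Φ.continuous_transition i
    ext X
    apply (Φ.e i).coord_injective hx
    have heq : (fun y => (Φ.e i).coord y ((g • σ) y)) =
        fun y => g y • (Φ.e i).coord y (σ y) := by
      funext y
      exact map_smul _ _ _
    rw [add_apply, map_add, smul_apply, map_smul, coord_glue he hsub hx hσ,
      coord_glue he hsub hx (hg.smul_section hσ), heq,
      mvfderiv_fun_smul hg ((Φ.e i).mdifferentiableAt_coord hx hσ)]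
    simp only [add_apply, smul_apply, ContinuousLinearMap.smulRight_apply, Pi.smul_apply',
      map_smul, lie_smul, smul_add]
    abel

variable [IsManifold 𝓘(ℝ, E) ∞ M]

lemma contMDiff_glue (hsub : h.IsSubordinate Φ.U) {X : ∀ y : M, TangentSpace 𝓘(ℝ, E) y}
    (hX : ContMDiff 𝓘(ℝ, E) 𝓘(ℝ, E).tangent ∞ (fun y => (⟨y, X y⟩ : TangentBundle 𝓘(ℝ, E) M)))
    {u : ∀ y, V y}
    (hu : ContMDiff 𝓘(ℝ, E) (𝓘(ℝ, E).prod 𝓘(ℝ, 𝔤)) ∞ (fun y => TotalSpace.mk' 𝔤 y (u y))) :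
    ContMDiff 𝓘(ℝ, E) (𝓘(ℝ, E).prod 𝓘(ℝ, 𝔤)) ∞
      (fun x => TotalSpace.mk' 𝔤 x (Φ.glue h u x (X x))) := by
  intro x
  obtain ⟨i, hx⟩ := Φ.cover x
  refine (Φ.e i).contMDiffAt_of_coord hx ?_
  have ho := (Φ.e i).triv.open_baseSet
  have hc : ContMDiffOn 𝓘(ℝ, E) 𝓘(ℝ, 𝔤) ∞ (fun y => (Φ.e i).coord y (u y))
      (Φ.e i).triv.baseSet := fun y hy =>
    ((Φ.e i).contMDiffAt_coord hy hu.contMDiffAt).contMDiffWithinAt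
  have h1 : ContMDiffAt 𝓘(ℝ, E) 𝓘(ℝ, 𝔤) ∞
      (fun y => mvfderiv 𝓘(ℝ, E) (fun z => (Φ.e i).coord z (u z)) y (X y)) x :=
    ((hc.contMDiffOn_mvfderiv ho).contMDiffAt (x := (⟨x, X x⟩ : TangentBundle 𝓘(ℝ, E) M))
      ((ho.preimage (FiberBundle.continuous_proj E _)).mem_nhds hx)).comp x hX.contMDiffAt
  have h2 : ContMDiffAt 𝓘(ℝ, E) 𝓘(ℝ, 𝔤) ∞
      (fun y => adCLM 𝔤 (Φ.connForm h (Φ.e i) y (X y)) ((Φ.e i).coord y (u y))) x :=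
    ((adCLM 𝔤).contMDiff.contMDiffAt.comp x
      ((isSmoothFormOn_connForm hsub (Φ.e i)).contMDiffAt ho hx hX.contMDiffAt)).clm_apply
      (hc.contMDiffAt (ho.mem_nhds hx))
  refine (h1.add h2).congr_of_eventuallyEq ?_
  filter_upwards [ho.mem_nhds hx] with y hy
  exact coord_glue (Φ.continuous_transition i) hsub hy
    (hu.contMDiffAt.mdifferentiableAt (by simp)) (X y)

lemma coord_curvatureAt_glue [CompleteSpace E] (hsub : h.IsSubordinate Φ.U) {i : Φ.ι} {x : M}
    (hx : x ∈ (Φ.e i).triv.baseSet) {X Y : ∀ y : M, TangentSpace 𝓘(ℝ, E) y}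
    (hX : ContMDiff 𝓘(ℝ, E) 𝓘(ℝ, E).tangent ∞ (fun y => (⟨y, X y⟩ : TangentBundle 𝓘(ℝ, E) M)))
    (hY : ContMDiff 𝓘(ℝ, E) 𝓘(ℝ, E).tangent ∞ (fun y => (⟨y, Y y⟩ : TangentBundle 𝓘(ℝ, E) M)))
    {u : ∀ y, V y}
    (hu : ContMDiff 𝓘(ℝ, E) (𝓘(ℝ, E).prod 𝓘(ℝ, 𝔤)) ∞ (fun y => TotalSpace.mk' 𝔤 y (u y))) :
    (Φ.e i).coord x (curvatureAt (Φ.glue h) X Y u x) =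
      ⁅curvatureExpr (Φ.connForm h (Φ.e i)) x X Y, (Φ.e i).coord x (u x)⁆ := by
  have he := Φ.continuous_transition i
  have ho := (Φ.e i).triv.open_baseSet
  have hux := (hu.contMDiffAt (x := x)).mdifferentiableAt (by simp)
  -- `∇_Z u` is differentiated once more, so its local form is needed near `x` and not just at `x`.
  have heq : ∀ Z : ∀ y : M, TangentSpace 𝓘(ℝ, E) y,
      (fun y => (Φ.e i).coord y (Φ.glue h u y (Z y))) =ᶠ[𝓝 x]
        fun y => mvfderiv 𝓘(ℝ, E) (fun z => (Φ.e i).coord z (u z)) y (Z y) +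
          ⁅Φ.connForm h (Φ.e i) y (Z y), (Φ.e i).coord y (u y)⁆ := by
    intro Z
    filter_upwards [ho.mem_nhds hx] with y hy
    exact coord_glue he hsub hy (hu.contMDiffAt.mdifferentiableAt (by simp)) (Z y)
  rw [curvatureAt, map_sub, map_sub,
    coord_glue he hsub hx ((contMDiff_glue hsub hY hu).contMDiffAt.mdifferentiableAt (by simp)),
    coord_glue he hsub hx ((contMDiff_glue hsub hX hu).contMDiffAt.mdifferentiableAt (by simp)),
    mvfderiv_congr (heq X), mvfderiv_congr (heq Y), coord_glue he hsub hx hux (X x),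
    coord_glue he hsub hx hux (Y x), coord_glue he hsub hx hux]
  exact (isSmoothFormOn_connForm hsub (Φ.e i)).curvature_eq_lie ho hx
    (hX.contMDiffAt.mdifferentiableAt (by simp)) (hY.contMDiffAt.mdifferentiableAt (by simp))
    (u := fun y => (Φ.e i).coord y (u y)) fun y hy =>
      ((Φ.e i).contMDiffAt_coord hy hu.contMDiffAt).contMDiffWithinAt

variable [∀ x, ContinuousSMul ℝ (V x)] [VectorBundle ℝ 𝔤 V]

/-- The local curvature forms may differ by central values, so they are averaged; bracketing with
`u` gives the curvature for each of them, hence for the average. -/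
lemma exists_curvature_glue_eq_lie [FiniteDimensional ℝ E] (hsub : h.IsSubordinate Φ.U) :
    ∃ Ω : TwoForm 𝓘(ℝ, E) 𝔤 V,
      ∀ (X Y : Cₛ^∞⟮𝓘(ℝ, E); E, (TangentSpace 𝓘(ℝ, E) : M → Type _)⟯)
        (u : Cₛ^∞⟮𝓘(ℝ, E); 𝔤, V⟯) (x : M),
        curvatureAt (Φ.glue h) X Y u x = ⁅Ω.toFun x (X x) (Y x), u x⁆ := by
  have : CompleteSpace E := FiniteDimensional.complete ℝ E
  choose Ω hΩ0 hΩ using fun i => (isSmoothFormOn_connForm hsub (Φ.e i)).exists_curvatureForm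
    (Φ.e i).triv.open_baseSet
  let Ψ : ∀ x : M, TangentSpace 𝓘(ℝ, E) x →L[ℝ] TangentSpace 𝓘(ℝ, E) x →L[ℝ] V x := fun x =>
    ∑ i ∈ h.finsupport x,
      h i x • (ContinuousLinearMap.postcomp _ ((Φ.e i).coordSymm x)).comp (Ω i x)
  have hΨ : ∀ x X Y, Ψ x X Y = ∑ᶠ i, h i x • (Φ.e i).coordSymm x (Ω i x X Y) := by
    intro x X Y
    rw [h.finsum_smul_eq_sum]
    simp only [Ψ, sum_apply]
    rfl
  refine ⟨⟨Ψ, fun x X => ?_, fun X Y => ?_⟩, fun X Y u x => ?_⟩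
  · simp [hΨ, hΩ0]
  · simp only [hΨ]
    refine SmoothPartitionOfUnity.contMDiff_finsum_smul_section hsub fun i x hx => ?_
    refine (Φ.e i).contMDiffAt_mk_coordSymm hx ?_
    refine ((isSmoothFormOn_connForm hsub (Φ.e i)).contMDiffAt_curvatureExpr
      (Φ.e i).triv.open_baseSet hx X.contMDiff Y.contMDiff).congr_of_eventuallyEq ?_
    filter_upwards [(Φ.e i).baseSet_mem_nhds hx] with y hy
    exact hΩ i y hy X Y (X.contMDiff.contMDiffAt.mdifferentiableAt (by simp))
      (Y.contMDiff.contMDiffAt.mdifferentiableAt (by simp))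
  · change _ = ⁅Ψ x (X x) (Y x), u x⁆
    rw [hΨ, h.finsum_smul_lie]
    refine (SmoothPartitionOfUnity.finsum_smul_eq_of_forall hsub fun i hx => ?_).symm
    apply (Φ.e i).coord_injective hx
    rw [(Φ.e i).coord_lie hx, (Φ.e i).coord_coordSymm hx,
      coord_curvatureAt_glue hsub hx X.contMDiff Y.contMDiff u.contMDiff,
      hΩ i x hx X Y (X.contMDiff.contMDiffAt.mdifferentiableAt (by simp))
        (Y.contMDiff.contMDiffAt.mdifferentiableAt (by simp))]

/-- The coupling connection of a locally trivial structure and a partition of unity. -/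
def couplingConnection [FiniteDimensional ℝ E] (hsub : h.IsSubordinate Φ.U) :
    CouplingConnection 𝓘(ℝ, E) 𝔤 V where
  toFun := Φ.glue h
  isCovariantDerivativeOnUniv := isCovariantDerivativeOn_glue hsub
  contMDiff X u := contMDiff_glue hsub X.contMDiff u.contMDiff
  leibniz_lie u v _ X := glue_lie hsub u.contMDiff v.contMDiff X
  inner_curvature := exists_curvature_glue_eq_lie hsub

/-- Equivalence makes every `Φ.e i` compatible with `Φ'` as well, so both connections have
connection forms there. The form `l` averages their differences; `Φ' = Φ` covers a change of
partition. -/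
lemma Equivalent.exists_glue_eq_add_lie {Φ' : DeltaStructure.{w} 𝓘(ℝ, E) 𝔤 V}
    (hΦ : Φ.Equivalent Φ') {h' : SmoothPartitionOfUnity Φ'.ι 𝓘(ℝ, E) M univ}
    (hsub : h.IsSubordinate Φ.U) (hsub' : h'.IsSubordinate Φ'.U) :
    ∃ l : OneForm 𝓘(ℝ, E) 𝔤 V, ∀ (u : Cₛ^∞⟮𝓘(ℝ, E); 𝔤, V⟯) (x : M) (X : TangentSpace 𝓘(ℝ, E) x),
      Φ'.glue h' u x X = Φ.glue h u x X + ⁅l.toFun x X, u x⁆ := by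
  let l : ∀ x : M, TangentSpace 𝓘(ℝ, E) x →L[ℝ] V x := fun x =>
    ∑ᶠ i, h i x • ((Φ.e i).coordSymm x).comp
      (Φ'.connForm h' (Φ.e i) x - Φ.connForm h (Φ.e i) x)
  have hl : ∀ x X, l x X = ∑ᶠ i, h i x • (Φ.e i).coordSymm x
      (Φ'.connForm h' (Φ.e i) x X - Φ.connForm h (Φ.e i) x X) := by
    intro x X
    simp only [l, h.finsum_smul_eq_sum, sum_apply, smul_apply]
    rfl
  refine ⟨⟨l, fun X => ?_⟩, fun u x X => ?_⟩
  · simp only [hl]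
    refine SmoothPartitionOfUnity.contMDiff_finsum_smul_section hsub fun i x hx => ?_
    have ho := (Φ.e i).triv.open_baseSet
    exact (Φ.e i).contMDiffAt_mk_coordSymm hx
      (((isSmoothFormOn_connForm hsub' (Φ.e i)).contMDiffAt ho hx X.contMDiff.contMDiffAt).sub
        ((isSmoothFormOn_connForm hsub (Φ.e i)).contMDiffAt ho hx X.contMDiff.contMDiffAt))
  · change _ = _ + ⁅l x X, u x⁆
    rw [hl, h.finsum_smul_lie, ← sub_eq_iff_eq_add']
    refine (SmoothPartitionOfUnity.finsum_smul_eq_of_forall hsub fun i hx => ?_).symm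
    have hu := (u.contMDiff.contMDiffAt (x := x)).mdifferentiableAt (by simp)
    apply (Φ.e i).coord_injective hx
    rw [(Φ.e i).coord_lie hx, (Φ.e i).coord_coordSymm hx, map_sub,
      coord_glue (hΦ i) hsub' hx hu, coord_glue (Φ.continuous_transition i) hsub hx hu, sub_lie]
    abel

end DeltaStructure

end GluedConnection

end

theorem mainTheorem2
    {E : Type u₁} [NormedAddCommGroup E] [NormedSpace ℝ E] [FiniteDimensional ℝ E]
    {M : Type u₃} [TopologicalSpace M] [T2Space M] [SigmaCompactSpace M]
    [ChartedSpace E M] [IsManifold 𝓘(ℝ, E) ∞ M]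
    {𝔤 : Type u₄} [LieNormedGroup 𝔤] [LieNormedSpace 𝔤] [FiniteDimensional ℝ 𝔤]
    {V : M → Type u₅} [TopologicalSpace (TotalSpace 𝔤 V)]
    [∀ x, LieRing (V x)] [∀ x, LieAlgebra ℝ (V x)] [∀ x, TopologicalSpace (V x)]
    [∀ x, IsTopologicalAddGroup (V x)] [∀ x, ContinuousSMul ℝ (V x)]
    [FiberBundle 𝔤 V] [VectorBundle ℝ 𝔤 V] [ContMDiffVectorBundle ∞ 𝔤 V 𝓘(ℝ, E)]
    (hL : IsLieAlgebraBundle 𝓘(ℝ, E) 𝔤 V) :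
    -- the glued connection of `(Φ, H)` is a connection with inner curvature
    (∀ (Φ : DeltaStructure.{w} 𝓘(ℝ, E) 𝔤 V)
      (h : SmoothPartitionOfUnity Φ.ι 𝓘(ℝ, E) M univ), h.IsSubordinate Φ.U →
      ∃ c : CouplingConnection 𝓘(ℝ, E) 𝔤 V, c.toFun = Φ.glue h) ∧
    -- its class does not depend on the choice of `Φ` in its equivalence class and of `H`
    (∀ (Φ Φ' : DeltaStructure.{w} 𝓘(ℝ, E) 𝔤 V)
      (h : SmoothPartitionOfUnity Φ.ι 𝓘(ℝ, E) M univ)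
      (h' : SmoothPartitionOfUnity Φ'.ι 𝓘(ℝ, E) M univ)
      (c c' : CouplingConnection 𝓘(ℝ, E) 𝔤 V),
      Φ.Equivalent Φ' → h.IsSubordinate Φ.U → h'.IsSubordinate Φ'.U →
      c.toFun = Φ.glue h → c'.toFun = Φ'.glue h' → c.Equivalent c') ∧
    -- so that `[Φ] ↦ [∇^{Φ,H}]` is a well-defined map `LAB^δ(L) → Coup(L)`
    ∃! g : LABDelta.{w} 𝓘(ℝ, E) 𝔤 V → Coup 𝓘(ℝ, E) 𝔤 V,
      ∀ (Φ : DeltaStructure.{w} 𝓘(ℝ, E) 𝔤 V)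
        (h : SmoothPartitionOfUnity Φ.ι 𝓘(ℝ, E) M univ) (c : CouplingConnection 𝓘(ℝ, E) 𝔤 V),
        h.IsSubordinate Φ.U → c.toFun = Φ.glue h →
        g (Quotient.mk _ Φ) = Quotient.mk _ c := by
  have indep : ∀ (Φ Φ' : DeltaStructure.{w} 𝓘(ℝ, E) 𝔤 V)
      (h : SmoothPartitionOfUnity Φ.ι 𝓘(ℝ, E) M univ)
      (h' : SmoothPartitionOfUnity Φ'.ι 𝓘(ℝ, E) M univ)
      (c c' : CouplingConnection 𝓘(ℝ, E) 𝔤 V),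
      Φ.Equivalent Φ' → h.IsSubordinate Φ.U → h'.IsSubordinate Φ'.U →
      c.toFun = Φ.glue h → c'.toFun = Φ'.glue h' → c.Equivalent c' := by
    intro Φ Φ' h h' c c' hΦ hsub hsub' hc hc'
    obtain ⟨l, hl⟩ := hΦ.exists_glue_eq_add_lie hsub hsub'
    exact ⟨l, fun u x X => by rw [hc, hc', hl]⟩
  -- An auxiliary partition for each `Φ` defines the map; its existence also forces uniqueness.
  choose H hH using fun Φ : DeltaStructure.{w} 𝓘(ℝ, E) 𝔤 V => Φ.exists_isSubordinate
  refine ⟨fun Φ h hsub => ⟨DeltaStructure.couplingConnection hsub, rfl⟩, indep,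
    Quotient.lift (fun Φ => Quotient.mk _ (DeltaStructure.couplingConnection (hH Φ)))
      fun Φ Φ' hΦ => Quotient.sound (indep Φ Φ' _ _ _ _ hΦ (hH Φ) (hH Φ') rfl rfl),
    fun Φ h c hsub hc => ?_, fun g hg => funext fun q => ?_⟩
  · exact Quotient.sound
      (indep Φ Φ _ _ _ _ Φ.continuous_transition (hH Φ) hsub rfl hc)
  · induction q using Quotient.ind with
    | _ Φ => exact hg Φ (H Φ) _ (hH Φ) rfl
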